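/- Let $k$ be an algebraically closed field of characteristic $0$ and $n\ge 1$. View $S_n$ as the group of bijections of $\mathbb Z/n$, $S_{n-1}$ as the subgroup fixing $0$ (the class of $n$), and $C_n=\langle a\rangle$ with $a(u)=u+1$. The factorization $S_n=C_nS_{n-1}$ gives the matched pair $x\rhd a^r=a^{x(r)}$, $x\lhd a^r=a^{-x(r)}xa^r$, and $J_n=k^{S_{n-1}}\#kC_n$ is its bismash product Hopf algebra, with basis $p_x\#b$ ($x\in S_{n-1}$, $b\in C_n$) and $$(p_x\#b)(p_y\#c)=\delta_{y,x\lhd b}\,p_x\#bc,\qquad \Delta(p_x\#b)=\sum_{y}(p_{xy^{-1}}\#(y\rhd b))\otimes(p_y\#b),\qquad \varepsilon(p_x\#b)=\delta_{x,1}.$$ For a finite-dimensional $J_n$-module with character $\chi$ the (Frobenius–Schur) indicator is $\nu(\chi)=\chi(\sum\Lambda_1\Lambda_2)$, where $\Lambda$ is the two-sided integral of $J_n$ with $\varepsilon(\Lambda)=1$. For $x\in S_{n-1}$ let $F_x=\{b\in C_n: x\lhd b=x\}$ and $\mathcal O_x=\{x\lhd b: b\in C_n\}$. For an irreducible representation $\rho:F_x\to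 k^\times$ let $\hat V_{x,\rho}=kC_n\otimes_{kF_x}\rho$ be the induced $J_n$-module, with $(p_y\#b)(c\otimes v)=\delta_{y\lhd bc,\,x}\,(bc\otimes v)$. Irreps of $J_n$ are counted as the modules $\hat V_{x,\rho}$, one for every pair $(x,\rho)$ with $x\in S_{n-1}$: each $\hat V_{x,\rho}$ is irreducible, and every irreducible $J_n$-module of dimension $t$ is isomorphic to $\hat V_{x,\rho}$ for exactly $t$ pairs $(x,\rho)$ (so the counts below are $t$ times the numbers of isomorphism classes). For a divisor $t$ of $n$ let $I^{(\epsilon)}_{n/t}$ be the number of irreps of dimension $t$ with indicator $\epsilon$, counted in this way. Let - $E_{n/t}=\{1\le j\le n/t : j^2\equiv 1 \bmod n/t\}$ and $\alpha_{j,n/t}=\gcd(j+1,n/t)$; - $M_{n/t}=\{x\in S_{n-1}: F_x=\langle a^t\rangle\}$; - $O_{n/t,r}$ be the set of orbits $\mathcal O_x$ of length $t$ that contain exactly $r$ elements $y$ with $y=y^{-1}$ (the identity included); - $O_{n/t,r,j}$ be the set of those orbits in $O_{n/t,r}$ all of whose elements $y$ satisfy $y(t)=jt$ in $\mathbb Z/n$.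 **Theorem.** (1) $I^{(+1)}_{n/1}=\sum_{j\in E_{n/1}}\alpha_{j,n/1}=\sum_{j\in E_{n/1}}\gcd(j+1,n)$. (2) For every odd divisor $t$ of $n$, $$I^{(+1)}_{n/t}=t\sum_{j\in E_{n/t}}\sum_{r=1}^{t}\alpha_{j,n/t}\,|O_{n/t,r,j}|.$$ (3) If $n$ is odd, $I^{(+1)}_{n/n}=n\sum_{r=1}^{n}|O_{n/n,r}|$. (4) For every odd divisor $t$ of $n$, the total number of irreps of dimension $t$ is $\frac nt|M_{n/t}|$, and the number of those with indicator $0$ is $I^{(0)}_{n/t}=\frac nt|M_{n/t}|-I^{(+1)}_{n/t}$; that is, all irreps of dimension $t$ that do not have indicator $+1$ have indicator $0$. -/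

import Mathlib

open scoped TensorProduct

/-- A matched pair of groups: a right action `x ◁ a` (`right x a`) of `F` on the set `G` and a left
action `x ▷ a` (`left x a`) of `G` on the set `F` that satisfy the two compatibility laws. -/
structure MatchedPair (F G : Type*) [Group F] [Group G] where
  right : G → F → G
  left : G → F → F
  right_one : ∀ x, right x 1 = x
  right_mul : ∀ x a b, right x (a * b) = right (right x a) b
  one_left : ∀ a, left 1 a = a
  mul_left : ∀ x y a, left (x * y) a = left x (left y a)
  left_mul : ∀ x a b, left x (a * b) = left x a * left (right x a) b
  mul_right : ∀ x y a, right (x * y) a = right x (left y a) * right y a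

namespace MatchedPair

variable {F G : Type*} [Group F] [Group G] (M : MatchedPair F G)

theorem left_one (x : G) : M.left x 1 = 1 := by
  have h := M.left_mul x 1 1
  rw [M.right_one, mul_one] at h
  exact (mul_eq_left.mp h.symm)

theorem one_right (a : F) : M.right 1 a = 1 := by
  have h := M.mul_right 1 1 a
  rw [M.one_left, mul_one] at h
  exact (mul_eq_left.mp h.symm)

theorem right_right_inv (x : G) (a : F) : M.right (M.right x a) a⁻¹ = x := by
  rw [← M.right_mul, mul_inv_cancel, M.right_one]

theorem right_inv_right (x : G) (a : F) : M.right (M.right x a⁻¹) a = x := by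
  rw [← M.right_mul, inv_mul_cancel, M.right_one]

theorem left_inv (x : G) (a : F) : M.left (M.right x a) a⁻¹ = (M.left x a)⁻¹ := by
  have h := M.left_mul x a a⁻¹
  rw [mul_inv_cancel, M.left_one] at h
  exact (inv_eq_of_mul_eq_one_right h.symm).symm

/-- `(x y⁻¹) ◁ (y ▷ a) = (x ◁ a) (y ◁ a)⁻¹`. -/
theorem right_div (x y : G) (a : F) :
    M.right (x * y⁻¹) (M.left y a) = M.right x a * (M.right y a)⁻¹ := by
  have h := M.mul_right (x * y⁻¹) y a
  rw [inv_mul_cancel_right] at h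
  rw [h, mul_inv_cancel_right]

/-- The permutation `x ↦ x ◁ a` of the set `G`. -/
def rightEquiv (a : F) : G ≃ G where
  toFun x := M.right x a
  invFun x := M.right x a⁻¹
  left_inv x := M.right_right_inv x a
  right_inv x := M.right_inv_right x a

/-- The stabilizer `F_x = {a | x ◁ a = x}`. -/
def stab (x : G) : Subgroup F where
  carrier := {a | M.right x a = x}
  one_mem' := M.right_one x
  mul_mem' := by
    intro a b ha hb
    simp only [Set.mem_ofPred_eq] at *
    rw [M.right_mul, ha, hb]
  inv_mem' := by
    intro a ha
    simp only [Set.mem_ofPred_eq] at *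
    conv_lhs => rw [← ha]
    exact M.right_right_inv x a

theorem mem_stab {x : G} {a : F} : a ∈ M.stab x ↔ M.right x a = x := Iff.rfl

/-- The orbit `O_x = {x ◁ a | a ∈ F}`. -/
def orbit (x : G) : Set G := Set.range (M.right x)

end MatchedPair

/-- The bismash product `k^G # kF` of a matched pair: the free `k`-module on the elements
`p_x # a` with `x ∈ G` and `a ∈ F`. -/
def Bismash (k : Type*) [CommRing k] {F G : Type*} [Group F] [Group G]
    (_M : MatchedPair F G) : Type _ := G × F →₀ k

namespace Bismash

section Basic

variable {k : Type*} [CommRing k] {F G : Type*} [Group F] [Group G] {M : MatchedPair F G}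

noncomputable instance : AddCommGroup (Bismash k M) := inferInstanceAs (AddCommGroup (G × F →₀ k))

noncomputable instance : Module k (Bismash k M) := inferInstanceAs (Module k (G × F →₀ k))

variable (k M) in
/-- The basis element `p_x # a`. -/
noncomputable def e (x : G) (a : F) : Bismash k M := Finsupp.single (x, a) (1 : k)

variable (k M) in
/-- The basis `p_x # a`. -/
noncomputable def basis : Module.Basis (G × F) k (Bismash k M) :=
  Module.Basis.ofRepr (LinearEquiv.refl k (G × F →₀ k))

theorem basis_apply (p : G × F) : basis k M p = e k M p.1 p.2 := rfl

/-- The `k`-linear map with prescribed values on the elements `p_x # a`. -/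
noncomputable def lift {V : Type*} [AddCommGroup V] [Module k V] (f : G → F → V) :
    Bismash k M →ₗ[k] V :=
  (basis k M).constr k (fun p => f p.1 p.2)

@[simp] theorem lift_e {V : Type*} [AddCommGroup V] [Module k V] (f : G → F → V) (x : G) (a : F) :
    lift f (e k M x a) = f x a :=
  (basis k M).constr_basis k (fun p => f p.1 p.2) (x, a)

theorem hom_ext {V : Type*} [AddCommGroup V] [Module k V] {f g : Bismash k M →ₗ[k] V}
    (h : ∀ x a, f (e k M x a) = g (e k M x a)) : f = g :=
  (basis k M).ext fun p => h p.1 p.2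

theorem induction {P : Bismash k M → Prop} (add : ∀ f g, P f → P g → P (f + g))
    (smul : ∀ (r : k) f, P f → P (r • f)) (he : ∀ x a, P (e k M x a)) (h0 : P 0)
    (f : Bismash k M) : P f := by
  refine Finsupp.induction_linear (motive := P) f h0 add ?_
  rintro ⟨x, a⟩ r
  have h : (Finsupp.single (x, a) r : G × F →₀ k) = r • Finsupp.single (x, a) (1 : k) := by simp
  rw [h]
  exact smul r _ (he x a)

open Classical in
/-- Multiplication: `(p_x # a) (p_y # b) = p_x # ab` if `y = x ◁ a`, and `0` otherwise. -/
noncomputable def mulL : Bismash k M →ₗ[k] Bismash k M →ₗ[k] Bismash k M :=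
  lift fun x a => lift fun y b => if y = M.right x a then e k M x (a * b) else 0

noncomputable instance : Mul (Bismash k M) := ⟨fun f g => mulL f g⟩

theorem mul_def (f g : Bismash k M) : f * g = mulL f g := rfl

open Classical in
theorem e_mul_e (x y : G) (a b : F) :
    e k M x a * e k M y b = if y = M.right x a then e k M x (a * b) else 0 := by
  simp [mul_def, mulL]

theorem mul_assoc' (f g h : Bismash k M) : f * g * h = f * (g * h) := by
  classical
  induction f using induction with
  | add f f' hf hf' => simp only [mul_def, map_add, LinearMap.add_apply] at *; rw [hf, hf']
  | smul r f hf => simp only [mul_def, map_smul, LinearMap.smul_apply] at *; rw [hf]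
  | h0 => simp [mul_def]
  | he x a =>
  induction g using induction with
  | add f f' hf hf' => simp only [mul_def, map_add, LinearMap.add_apply] at *; rw [hf, hf']
  | smul r f hf => simp only [mul_def, map_smul, LinearMap.smul_apply] at *; rw [hf]
  | h0 => simp [mul_def]
  | he y b =>
  induction h using induction with
  | add f f' hf hf' => simp only [mul_def, map_add] at *; rw [hf, hf']
  | smul r f hf => simp only [mul_def, map_smul] at *; rw [hf]
  | h0 => simp [mul_def]
  | he z c =>
  have z1 : ∀ u : Bismash k M, 0 * u = 0 := fun u => by simp [mul_def]
  have z2 : ∀ u : Bismash k M, u * 0 = 0 := fun u => by simp [mul_def]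
  rw [e_mul_e, e_mul_e]
  by_cases h1 : y = M.right x a
  · subst h1
    rw [if_pos rfl, e_mul_e, M.right_mul]
    by_cases h2 : z = M.right (M.right x a) b
    · rw [if_pos h2, if_pos h2, e_mul_e, if_pos rfl, mul_assoc]
    · rw [if_neg h2, if_neg h2, z2]
  · rw [if_neg h1, z1]
    split_ifs with h2
    · rw [e_mul_e, if_neg h1]
    · rw [z2]

variable [Fintype G]

/-- The unit `1 # 1 = ∑ x, p_x # 1`. -/
noncomputable instance : One (Bismash k M) := ⟨∑ x : G, e k M x 1⟩

theorem one_def : (1 : Bismash k M) = ∑ x : G, e k M x 1 := rfl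

theorem one_mul' (f : Bismash k M) : 1 * f = f := by
  classical
  induction f using induction with
  | add f f' hf hf' => simp only [mul_def, map_add] at *; rw [hf, hf']
  | smul r f hf => simp only [mul_def, map_smul] at *; rw [hf]
  | h0 => simp [mul_def]
  | he x a =>
  rw [one_def, mul_def, map_sum, LinearMap.sum_apply]
  have key : ∀ y : G, mulL (e k M y 1) (e k M x a) = if x = y then e k M x a else 0 := by
    intro y
    rw [← mul_def, e_mul_e, M.right_one, one_mul]
    split_ifs with h
    · rw [h]
    · rfl
  simp [key]

theorem mul_one' (f : Bismash k M) : f * 1 = f := by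
  classical
  induction f using induction with
  | add f f' hf hf' => simp only [mul_def, map_add, LinearMap.add_apply] at *; rw [hf, hf']
  | smul r f hf => simp only [mul_def, map_smul, LinearMap.smul_apply] at *; rw [hf]
  | h0 => simp [mul_def]
  | he x a =>
  rw [one_def, mul_def, map_sum]
  have key : ∀ y : G, mulL (e k M x a) (e k M y 1) =
      if y = M.right x a then e k M x a else 0 := by
    intro y
    rw [← mul_def, e_mul_e, mul_one]
  simp [key]

noncomputable instance : Ring (Bismash k M) :=
  { (inferInstance : AddCommGroup (Bismash k M)) with
    mul := (· * ·)
    one := 1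
    left_distrib := fun f g h => by simp [mul_def]
    right_distrib := fun f g h => by simp [mul_def]
    zero_mul := fun f => by simp [mul_def]
    mul_zero := fun f => by simp [mul_def]
    mul_assoc := mul_assoc'
    one_mul := one_mul'
    mul_one := mul_one' }

noncomputable instance : Algebra k (Bismash k M) :=
  Algebra.ofModule (fun r f g => by simp [mul_def]) (fun r f g => by simp [mul_def])

open Classical in
/-- Counit: `ε (p_x # a) = 1` if `x = 1`, and `0` otherwise. -/
noncomputable def counitL : Bismash k M →ₗ[k] k := lift fun x _ => if x = 1 then 1 else 0

/-- Comultiplication: `Δ (p_x # a) = ∑ y, (p_{x y⁻¹} # (y ▷ a)) ⊗ (p_y # a)`. -/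
noncomputable def comulL : Bismash k M →ₗ[k] Bismash k M ⊗[k] Bismash k M :=
  lift fun x a => ∑ y : G, e k M (x * y⁻¹) (M.left y a) ⊗ₜ[k] e k M y a

/-- Antipode: `S (p_x # a) = p_{(x ◁ a)⁻¹} # (x ▷ a)⁻¹`. -/
noncomputable def antipodeL : Bismash k M →ₗ[k] Bismash k M :=
  lift fun x a => e k M (M.right x a)⁻¹ (M.left x a)⁻¹

noncomputable instance : Coalgebra k (Bismash k M) where
  comul := comulL
  counit := counitL
  coassoc := by
    refine hom_ext fun x a => ?_
    simp only [LinearMap.comp_apply, comulL, lift_e, map_sum, LinearMap.rTensor_tmul,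
      LinearMap.lTensor_tmul, TensorProduct.sum_tmul, TensorProduct.tmul_sum,
      LinearEquiv.coe_coe, TensorProduct.assoc_tmul]
    rw [Finset.sum_comm]
    conv_rhs => rw [Finset.sum_comm]
    conv_lhs => rw [Finset.sum_comm]
    refine Finset.sum_congr rfl fun y _ => ?_
    refine Fintype.sum_equiv (Equiv.mulRight y) _ _ fun z => ?_
    simp [M.mul_left, mul_assoc]
  rTensor_counit_comp_comul := by
    classical
    refine hom_ext fun x a => ?_
    simp only [LinearMap.comp_apply, comulL, lift_e, map_sum, LinearMap.rTensor_tmul, counitL,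
      mul_inv_eq_one, TensorProduct.mk_apply]
    rw [Finset.sum_eq_single x]
    · simp
    · intro y _ hy
      simp [Ne.symm hy]
    · simp
  lTensor_counit_comp_comul := by
    classical
    refine hom_ext fun x a => ?_
    simp only [LinearMap.comp_apply, comulL, lift_e, map_sum, LinearMap.lTensor_tmul, counitL]
    rw [Finset.sum_eq_single 1]
    · simp [M.one_left]
    · intro y _ hy
      simp [hy]
    · simp

theorem comul_e (x : G) (a : F) : Coalgebra.comul (R := k) (e k M x a) =
    ∑ y : G, e k M (x * y⁻¹) (M.left y a) ⊗ₜ[k] e k M y a := by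
  change comulL (e k M x a) = _
  rw [comulL, lift_e]

open Classical in
theorem counit_e (x : G) (a : F) :
    Coalgebra.counit (R := k) (e k M x a) = if x = 1 then 1 else 0 := by
  change counitL (e k M x a) = _
  rw [counitL, lift_e]

theorem comul_mul' (f g : Bismash k M) : Coalgebra.comul (R := k) (f * g) =
    Coalgebra.comul (R := k) f * Coalgebra.comul (R := k) g := by
  classical
  induction f using induction with
  | add f f' hf hf' => rw [add_mul, map_add, map_add, add_mul, hf, hf']
  | smul r f hf => rw [smul_mul_assoc, map_smul, map_smul, smul_mul_assoc, hf]
  | h0 => simp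
  | he x a =>
  induction g using induction with
  | add f f' hf hf' => rw [mul_add, map_add, map_add, mul_add, hf, hf']
  | smul r f hf => rw [mul_smul_comm, map_smul, map_smul, mul_smul_comm, hf]
  | h0 => simp
  | he y b =>
  rw [comul_e, comul_e, Finset.sum_mul_sum]
  have key : ∀ u : G, ∑ v : G, e k M (x * u⁻¹) (M.left u a) ⊗ₜ[k] e k M u a *
      e k M (y * v⁻¹) (M.left v b) ⊗ₜ[k] e k M v b =
      (e k M (x * u⁻¹) (M.left u a) * e k M (y * (M.right u a)⁻¹) (M.left (M.right u a) b)) ⊗ₜ[k]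
        e k M u (a * b) := by
    intro u
    rw [Finset.sum_eq_single (M.right u a)]
    · rw [Algebra.TensorProduct.tmul_mul_tmul, e_mul_e u, if_pos rfl]
    · intro v _ hv
      rw [Algebra.TensorProduct.tmul_mul_tmul, e_mul_e u, if_neg hv, TensorProduct.tmul_zero]
    · simp
  simp only [key, e_mul_e, M.right_div, mul_left_inj, ← M.left_mul]
  split_ifs with h
  · rw [comul_e]
  · simp

noncomputable instance : Bialgebra k (Bismash k M) :=
  Bialgebra.mk' k (Bismash k M)
    (by
      classical
      rw [one_def, map_sum]
      simp only [counit_e]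
      simp)
    (by
      classical
      intro f g
      induction f using induction with
      | add f f' hf hf' => rw [add_mul, map_add, map_add, add_mul, hf, hf']
      | smul r f hf => rw [smul_mul_assoc, map_smul, map_smul, smul_mul_assoc, hf]
      | h0 => simp
      | he x a =>
      induction g using induction with
      | add f f' hf hf' => rw [mul_add, map_add, map_add, mul_add, hf, hf']
      | smul r f hf => rw [mul_smul_comm, map_smul, map_smul, mul_smul_comm, hf]
      | h0 => simp
      | he y b =>
      rw [e_mul_e, counit_e, counit_e]
      by_cases hx : x = 1
      · subst hx
        rw [M.one_right, if_pos rfl, one_mul]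
        by_cases h : y = 1
        · rw [if_pos h, if_pos h, counit_e, if_pos rfl]
        · rw [if_neg h, if_neg h, map_zero]
      · rw [if_neg hx, zero_mul]
        by_cases h : y = M.right x a
        · rw [if_pos h, counit_e, if_neg hx]
        · rw [if_neg h, map_zero])
    (by
      rw [one_def, map_sum]
      simp only [comul_e, M.left_one]
      rw [Finset.sum_comm, Algebra.TensorProduct.one_def, one_def, TensorProduct.tmul_sum]
      refine Finset.sum_congr rfl fun y _ => ?_
      rw [TensorProduct.sum_tmul]
      exact Fintype.sum_equiv (Equiv.mulRight y⁻¹) _ _ fun z => rfl)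
    (fun {f g} => comul_mul' f g)

noncomputable instance : HopfAlgebra k (Bismash k M) where
  antipode := antipodeL
  mul_antipode_rTensor_comul := by
    classical
    refine hom_ext fun x a => ?_
    simp only [LinearMap.comp_apply, comul_e, counit_e, map_sum, LinearMap.rTensor_tmul,
      antipodeL, lift_e, LinearMap.mul'_apply, Algebra.linearMap_apply]
    have key : ∀ y : G, (y = M.right ((M.right x a * (M.right y a)⁻¹)⁻¹) (M.left x a)⁻¹) ↔
        x = 1 := by
      intro y
      have h := M.mul_right ((M.right x a * (M.right y a)⁻¹)⁻¹) (M.right x a) a⁻¹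
      rw [M.left_inv, M.right_right_inv, mul_inv_rev, inv_inv, inv_mul_cancel_right,
        M.right_right_inv] at h
      rw [mul_inv_rev, inv_inv, ← mul_left_inj x, ← h]
      exact mul_eq_left
    simp only [e_mul_e, M.right_div, ← M.mul_left, inv_mul_cancel_right, key]
    split_ifs with hx
    · subst hx
      simp only [M.one_left, M.one_right, one_mul, inv_inv, inv_mul_cancel, map_one]
      exact Fintype.sum_equiv (M.rightEquiv a) _ _ fun y => rfl
    · simp
  mul_antipode_lTensor_comul := by
    classical
    refine hom_ext fun x a => ?_
    simp only [LinearMap.comp_apply, comul_e, counit_e, map_sum, LinearMap.lTensor_tmul,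
      antipodeL, lift_e, LinearMap.mul'_apply, Algebra.linearMap_apply]
    have key : ∀ y : G, ((M.right y a)⁻¹ = M.right x a * (M.right y a)⁻¹) ↔ x = 1 := by
      intro y
      rw [eq_comm, mul_eq_right]
      constructor
      · intro h
        rw [← M.right_right_inv x a, h, M.one_right]
      · rintro rfl
        exact M.one_right a
    simp only [e_mul_e, M.right_div, key, mul_inv_cancel]
    split_ifs with hx
    · subst hx
      simp only [one_mul, map_one]
      exact Fintype.sum_equiv (Equiv.inv G) _ _ fun y => rfl
    · simp

end Basic

end Bismash

/-- `Λ` is the normalized two-sided integral of `H`: `hΛ = ε(h)Λ = Λh` for all `h`, `ε(Λ) = 1`. -/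
structure IsNormalizedIntegral (k : Type*) {H : Type*} [CommRing k] [Ring H] [Bialgebra k H]
    (Λ : H) : Prop where
  mul_eq : ∀ h : H, h * Λ = Coalgebra.counit (R := k) h • Λ
  eq_mul : ∀ h : H, Λ * h = Coalgebra.counit (R := k) h • Λ
  counit_eq : Coalgebra.counit (R := k) Λ = 1

theorem IsNormalizedIntegral.unique {k H : Type*} [CommRing k] [Ring H] [Bialgebra k H]
    {Λ Λ' : H} (h : IsNormalizedIntegral k Λ) (h' : IsNormalizedIntegral k Λ') : Λ = Λ' := by
  have h1 := h.mul_eq Λ'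
  rw [h'.eq_mul Λ, h.counit_eq, h'.counit_eq, one_smul, one_smul] at h1
  exact h1.symm

/-- The Frobenius–Schur indicator `ν(χ) = χ(∑ Λ₁ Λ₂)` of an `H`-module `V` with character `χ`,
where `Λ` is the normalized integral of `H`. -/
noncomputable def fsIndicator {k H : Type*} [Field k] [Ring H] [Bialgebra k H] (Λ : H)
    (V : Type*) [AddCommGroup V] [Module k V] [Module H V] [IsScalarTower k H V] : k :=
  LinearMap.trace k V
    (Algebra.lsmul k k V (LinearMap.mul' k H (Coalgebra.comul (R := k) Λ)))

namespace Bismash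

section Integral

variable (k : Type*) [Field k] {F G : Type*} [Group F] [Group G] [Fintype F] [Fintype G]
  (M : MatchedPair F G)

/-- `Λ = |F|⁻¹ ∑ a, p_1 # a`. -/
noncomputable def integral : Bismash k M := (Fintype.card F : k)⁻¹ • ∑ a : F, e k M 1 a

theorem isNormalizedIntegral [CharZero k] : IsNormalizedIntegral k (integral k M) where
  mul_eq h := by
    classical
    rw [integral, mul_smul_comm, smul_comm]
    congr 1
    induction h using induction with
    | add f f' hf hf' => rw [add_mul, map_add, add_smul, hf, hf']
    | smul r f hf => rw [smul_mul_assoc, map_smul, smul_assoc, hf]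
    | h0 => simp
    | he x a =>
    rw [Finset.mul_sum, counit_e]
    have key : (1 = M.right x a) ↔ x = 1 := by
      constructor
      · intro h
        rw [← M.right_right_inv x a, ← h, M.one_right]
      · rintro rfl
        exact (M.one_right a).symm
    simp only [e_mul_e, key]
    split_ifs with hx
    · subst hx
      rw [one_smul]
      exact Fintype.sum_equiv (Equiv.mulLeft a) _ _ fun b => rfl
    · simp
  eq_mul h := by
    classical
    rw [integral, smul_mul_assoc, smul_comm]
    congr 1
    induction h using induction with
    | add f f' hf hf' => rw [mul_add, map_add, add_smul, hf, hf']
    | smul r f hf => rw [mul_smul_comm, map_smul, smul_assoc, hf]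
    | h0 => simp
    | he x a =>
    rw [Finset.sum_mul, counit_e]
    simp only [e_mul_e, M.one_right]
    split_ifs with hx
    · rw [one_smul]
      exact Fintype.sum_equiv (Equiv.mulRight a) _ _ fun b => rfl
    · simp
  counit_eq := by
    classical
    rw [integral, map_smul, map_sum]
    simp [counit_e]

end Integral

section Induced

variable (k : Type*) [Field k] {F G : Type*} [Group F] [Group G] (M : MatchedPair F G)

/-- The induced module `kF ⊗_{kF_x} V`, where `V = k` with `F_x` acting through the character `χ`.
The tensor `∑ b⊗v` is written as the function `f : F → k` with `f (b h) = χ(h)⁻¹ f(b)` for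
`h ∈ F_x`; the pure tensor `b ⊗ v` is the function `b h ↦ χ(h)⁻¹ v` supported on `b F_x`
(see `pure`). -/
def Induced (x : G) (χ : M.stab x →* kˣ) : Submodule k (F → k) where
  carrier := {f | ∀ (b : F) (h : M.stab x), f (b * h) = ((χ h)⁻¹ : kˣ) * f b}
  add_mem' := by
    intro f g hf hg b h
    simp only [Pi.add_apply]
    rw [hf, hg, mul_add]
  zero_mem' := by
    intro b h
    simp
  smul_mem' := by
    intro r f hf b h
    simp only [Pi.smul_apply, smul_eq_mul]
    rw [hf, mul_left_comm]

variable {M} {x : G} {χ : M.stab x →* kˣ}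

variable {k}

open Classical in
/-- The action of `p_y # a`: on tensors, `(p_y # a) (b ⊗ v) = ab ⊗ v` if `y ◁ ab = x`, and `0`
otherwise (see `e_smul_pure`). -/
noncomputable def actE (χ : M.stab x →* kˣ) (y : G) (a : F) :
    Induced k M x χ →ₗ[k] Induced k M x χ where
  toFun f := ⟨fun c => if M.right y c = x then f.1 (a⁻¹ * c) else 0, by
    intro b h
    have hh : M.right x h = x := h.2
    have e1 : M.right y (b * h) = x ↔ M.right y b = x := by
      rw [M.right_mul]
      constructor
      · intro h1
        have h2 := M.right_right_inv (M.right y b) h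
        rw [h1] at h2
        rw [← h2]
        exact (M.stab x).inv_mem h.2
      · intro h1
        rw [h1, hh]
    simp only [e1]
    split_ifs
    · rw [← mul_assoc]
      exact f.2 _ h
    · simp⟩
  map_add' f g := by
    ext c
    simp only [Submodule.coe_add, Pi.add_apply]
    split_ifs <;> simp
  map_smul' r f := by
    ext c
    simp

/-- The action of the bismash product on the induced module. -/
noncomputable def act (χ : M.stab x →* kˣ) :
    Bismash k M →ₗ[k] Module.End k (Induced k M x χ) := lift (actE χ)

open Classical in
theorem act_e_apply (y : G) (a : F) (f : Induced k M x χ) (c : F) :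
    (act χ (e k M y a) f).1 c = if M.right y c = x then f.1 (a⁻¹ * c) else 0 := by
  rw [act, lift_e]
  rfl

open Classical in
/-- The pure tensor `b ⊗ v`. -/
noncomputable def pure (χ : M.stab x →* kˣ) (b : F) (v : k) : Induced k M x χ :=
  ⟨fun c => if h : b⁻¹ * c ∈ M.stab x then ((χ ⟨b⁻¹ * c, h⟩)⁻¹ : kˣ) * v else 0, by
    intro c h
    have e1 : b⁻¹ * (c * h) ∈ M.stab x ↔ b⁻¹ * c ∈ M.stab x := by
      rw [← mul_assoc]
      exact Subgroup.mul_mem_cancel_right _ h.2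
    beta_reduce
    by_cases h1 : b⁻¹ * c ∈ M.stab x
    · rw [dif_pos h1, dif_pos (e1.mpr h1)]
      have e2 : (⟨b⁻¹ * (c * h), e1.mpr h1⟩ : M.stab x) = ⟨b⁻¹ * c, h1⟩ * h := by
        ext
        simp [mul_assoc]
      rw [e2, map_mul, mul_inv_rev, Units.val_mul, mul_assoc]
    · rw [dif_neg h1, dif_neg (fun h2 => h1 (e1.mp h2)), mul_zero]⟩

/-- `bh ⊗ v = b ⊗ hv` for `h ∈ F_x`. -/
theorem pure_mul (b : F) (h : M.stab x) (v : k) :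
    pure χ (b * h) v = pure χ b ((χ h : k) * v) := by
  ext c
  have e1 : (b * h)⁻¹ * c ∈ M.stab x ↔ b⁻¹ * c ∈ M.stab x := by
    rw [mul_inv_rev, mul_assoc]
    exact Subgroup.mul_mem_cancel_left _ ((M.stab x).inv_mem h.2)
  by_cases h1 : b⁻¹ * c ∈ M.stab x
  · simp only [pure]
    rw [dif_pos h1, dif_pos (e1.mpr h1)]
    have e2 : (⟨(b * h)⁻¹ * c, e1.mpr h1⟩ : M.stab x) = h⁻¹ * ⟨b⁻¹ * c, h1⟩ := by
      ext
      simp [mul_assoc]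
    rw [e2, map_mul, mul_inv_rev, map_inv, inv_inv, Units.val_mul, mul_assoc]
  · simp only [pure]
    rw [dif_neg h1, dif_neg (fun h2 => h1 (e1.mp h2))]

variable [Fintype G]

theorem act_one : act χ (1 : Bismash k M) = 1 := by
  ext f c
  rw [one_def, map_sum, LinearMap.sum_apply]
  simp only [Submodule.coe_sum, Finset.sum_apply, act_e_apply, inv_one, one_mul]
  rw [Finset.sum_eq_single (M.right x c⁻¹)]
  · rw [if_pos (M.right_inv_right x c)]
    rfl
  · intro y _ hy
    refine if_neg fun h => hy ?_
    rw [← h, M.right_right_inv]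
  · simp

theorem act_mul (f g : Bismash k M) : act χ (f * g) = act χ f * act χ g := by
  induction f using induction with
  | add f f' hf hf' => rw [add_mul, map_add, map_add, add_mul, hf, hf']
  | smul r f hf => rw [smul_mul_assoc, map_smul, map_smul, smul_mul_assoc, hf]
  | h0 => simp
  | he y a =>
  induction g using induction with
  | add f f' hf hf' => rw [mul_add, map_add, map_add, mul_add, hf, hf']
  | smul r f hf => rw [mul_smul_comm, map_smul, map_smul, mul_smul_comm, hf]
  | h0 => simp
  | he z b =>
  ext v c
  rw [Module.End.mul_apply, act_e_apply, act_e_apply, e_mul_e]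
  have hz : M.right y c = M.right (M.right y a) (a⁻¹ * c) := by
    rw [← M.right_mul, mul_inv_cancel_left]
  by_cases h : z = M.right y a
  · subst h
    rw [if_pos rfl, act_e_apply, ← hz, mul_inv_rev, mul_assoc]
    split_ifs <;> rfl
  · rw [if_neg h, map_zero]
    by_cases h1 : M.right y c = x
    · rw [if_pos h1, if_neg]
      · rfl
      · intro h2
        apply h
        rw [hz, ← h2] at h1
        have h3 := congrArg (fun w => M.right w (a⁻¹ * c)⁻¹) h1
        simp only [M.right_right_inv] at h3
        exact h3.symm
    · rw [if_neg h1]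
      rfl

noncomputable instance : Module (Bismash k M) (Induced k M x χ) where
  smul f v := act χ f v
  one_smul v := by
    change act χ 1 v = v
    rw [act_one]
    rfl
  mul_smul f g v := by
    change act χ (f * g) v = act χ f (act χ g v)
    rw [act_mul]
    rfl
  smul_zero f := map_zero (act χ f)
  smul_add f := map_add (act χ f)
  add_smul f g v := by
    change act χ (f + g) v = act χ f v + act χ g v
    rw [map_add]
    rfl
  zero_smul v := by
    change act χ 0 v = 0
    rw [map_zero]
    rfl

theorem smul_def (f : Bismash k M) (v : Induced k M x χ) : f • v = act χ f v := rfl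

instance : IsScalarTower k (Bismash k M) (Induced k M x χ) where
  smul_assoc r f v := by
    rw [smul_def, smul_def, map_smul]
    rfl

open Classical in
/-- `(p_y # a) (b ⊗ v) = δ_{y ◁ ab, x} (ab ⊗ v)`. -/
theorem e_smul_pure (y : G) (a b : F) (v : k) :
    e k M y a • pure χ b v = if M.right y (a * b) = x then pure χ (a * b) v else 0 := by
  ext c
  rw [smul_def, act_e_apply]
  have h0 : (a * b)⁻¹ * c = b⁻¹ * (a⁻¹ * c) := by group
  by_cases hc : b⁻¹ * (a⁻¹ * c) ∈ M.stab x
  · have hx : M.right y c = x ↔ M.right y (a * b) = x := by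
      have e3 : c = a * b * (b⁻¹ * (a⁻¹ * c)) := by group
      have hh : M.right x (b⁻¹ * (a⁻¹ * c)) = x := hc
      constructor
      · intro h1
        rw [e3, M.right_mul] at h1
        have h2 := M.right_right_inv (M.right y (a * b)) (b⁻¹ * (a⁻¹ * c))
        rw [h1] at h2
        rw [← h2]
        exact (M.stab x).inv_mem hc
      · intro h1
        rw [e3, M.right_mul, h1, hh]
    simp only [hx]
    split_ifs
    · simp only [pure, h0]
    · rfl
  · have hc' : (a * b)⁻¹ * c ∉ M.stab x := by rwa [h0]
    have h1 : (pure χ b v).1 (a⁻¹ * c) = 0 := dif_neg hc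
    have h2 : (pure χ (a * b) v).1 c = 0 := dif_neg hc'
    rw [h1, ite_self]
    split_ifs
    · exact h2.symm
    · rfl

end Induced

end Bismash

/-- `S_{n-1}`, the permutations of `ℤ/n` (whose class `0` is the point `n`) that fix `0`. -/
abbrev PointStab (n : ℕ) : Type := MulAction.stabilizer (Equiv.Perm (ZMod n)) (0 : ZMod n)

/-- `C_n`; its generator `a` is `Multiplicative.ofAdd 1`. -/
abbrev Cyc (n : ℕ) : Type := Multiplicative (ZMod n)

/-- The embedding of `C_n` in `S_n` that sends `a ^ r` to the permutation `u ↦ u + r`. -/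
def rot (n : ℕ) : Cyc n →* Equiv.Perm (ZMod n) where
  toFun b := Equiv.addRight b.toAdd
  map_one' := by
    ext u
    simp
  map_mul' b c := by
    ext u
    simp [add_comm, add_left_comm]

theorem rot_apply {n : ℕ} (b : Cyc n) (u : ZMod n) : rot n b u = u + b.toAdd := rfl

theorem rot_inv_apply {n : ℕ} (b : Cyc n) (u : ZMod n) : (rot n b)⁻¹ u = u - b.toAdd := by
  rw [Equiv.Perm.inv_eq_iff_eq, rot_apply, sub_add_cancel]

theorem PointStab.apply_zero {n : ℕ} (x : PointStab n) : x.1 0 = 0 := x.2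

/-- `x ◁ a^r = a^{-x(r)} x a^r`. -/
def cycRight {n : ℕ} (x : PointStab n) (b : Cyc n) : PointStab n :=
  ⟨(rot n (Multiplicative.ofAdd (x.1 b.toAdd)))⁻¹ * x.1 * rot n b, by
    rw [MulAction.mem_stabilizer_iff, mul_assoc, mul_smul, inv_smul_eq_iff]
    simp [rot_apply]⟩

theorem cycRight_apply {n : ℕ} (x : PointStab n) (b : Cyc n) (u : ZMod n) :
    (cycRight x b).1 u = x.1 (u + b.toAdd) - x.1 b.toAdd :=
  rot_inv_apply _ _

/-- The matched pair of `C_n` and `S_{n-1}`: `x ▷ a^r = a^{x(r)}` and `x ◁ a^r = a^{-x(r)} x a^r`,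
so that `x b = (x ▷ b) (x ◁ b)` in `S_n`. -/
def cycPair (n : ℕ) : MatchedPair (Cyc n) (PointStab n) where
  right := cycRight
  left x b := Multiplicative.ofAdd (x.1 b.toAdd)
  right_one x := by
    ext u
    simp [cycRight_apply, x.apply_zero]
  right_mul x b c := by
    ext u
    simp only [cycRight_apply, toAdd_mul]
    rw [add_comm b.toAdd c.toAdd, ← add_assoc, sub_sub_sub_cancel_right]
  one_left b := by simp
  mul_left x y b := by simp
  left_mul x b c := by
    apply Multiplicative.toAdd.injective
    simp only [cycRight_apply, toAdd_mul, toAdd_ofAdd]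
    rw [add_comm b.toAdd c.toAdd, add_sub_cancel]
  mul_right x y b := by
    ext u
    simp [cycRight_apply]

/-- `x b = (x ▷ b) (x ◁ b)` in `S_n`. -/
theorem cycPair_factor {n : ℕ} (x : PointStab n) (b : Cyc n) :
    x.1 * rot n b = rot n ((cycPair n).left x b) * ((cycPair n).right x b).1 := by
  simp [cycPair, cycRight, mul_assoc]

/-- Every element of `S_n` is uniquely of the form `b x` with `b ∈ C_n` and `x ∈ S_{n-1}`. -/
theorem cyc_factor_unique {n : ℕ} (s : Equiv.Perm (ZMod n)) :
    ∃! p : Cyc n × PointStab n, s = rot n p.1 * p.2.1 := by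
  refine ⟨(Multiplicative.ofAdd (s 0), ⟨(rot n (Multiplicative.ofAdd (s 0)))⁻¹ * s, ?_⟩), ?_, ?_⟩
  · rw [MulAction.mem_stabilizer_iff, mul_smul, inv_smul_eq_iff]
    simp [rot_apply]
  · simp
  · rintro ⟨b, x⟩ rfl
    have h0 : (rot n b * x.1) 0 = b.toAdd := by simp [rot_apply, x.apply_zero]
    simp only [h0, ofAdd_toAdd, inv_mul_cancel_left]

noncomputable instance (n : ℕ) [NeZero n] : Fintype (PointStab n) := Fintype.ofFinite _

/-- The Hopf algebra `J_n = k^{S_{n-1}} # kC_n`. -/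
abbrev J (k : Type*) [Field k] (n : ℕ) : Type _ := Bismash k (cycPair n)

/-- The pairs of a permutation `x ∈ S_{n-1}` and an irreducible representation of the abelian
group `F_x`, that is, a character `ρ : F_x → kˣ`. -/
abbrev IrrepIndex (k : Type*) [Field k] (n : ℕ) : Type _ :=
  Σ x : PointStab n, ((cycPair n).stab x →* kˣ)

/-- The `J_n`-module induced from the representation `ρ` of `F_x`. -/
abbrev irrep {k : Type*} [Field k] {n : ℕ} (p : IrrepIndex k n) : Submodule k (Cyc n → k) :=
  Bismash.Induced k (cycPair n) p.1 p.2

/-- The Frobenius–Schur indicator of a `J_n`-module. -/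
noncomputable def indicator (k : Type*) [Field k] (n : ℕ) [NeZero n]
    (V : Type*) [AddCommGroup V] [Module k V] [Module (J k n) V] [IsScalarTower k (J k n) V] : k :=
  fsIndicator (Bismash.integral k (cycPair n)) V

/-- The number of irreps of dimension `t`, one for each pair `(x, ρ)`. -/
noncomputable def numIrreps (k : Type*) [Field k] (n t : ℕ) : ℕ :=
  Nat.card {p : IrrepIndex k n // Module.finrank k (irrep p) = t}

/-- The number of irreps of dimension `t` and indicator `ε`, one for each pair `(x, ρ)`. -/
noncomputable def numIrrepsInd (k : Type*) [Field k] (n : ℕ) [NeZero n] (t : ℕ) (ε : k) : ℕ :=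
  Nat.card {p : IrrepIndex k n //
    Module.finrank k (irrep p) = t ∧ indicator k n (irrep p) = ε}

/-- `M_{n/t}`, the set of `x ∈ S_{n-1}` with `F_x = ⟨a ^ t⟩`. -/
def stabSet (n t : ℕ) : Set (PointStab n) :=
  {x | (cycPair n).stab x = Subgroup.zpowers (Multiplicative.ofAdd (1 : ZMod n) ^ t)}

/-- `E_m = {1 ≤ j ≤ m | j² = 1 mod m}`. -/
def sqrtOne (m : ℕ) : Finset ℕ := (Finset.Icc 1 m).filter fun j => j ^ 2 ≡ 1 [MOD m]

/-- `O_{n/t,r}`, the set of orbits of length `t` with exactly `r` elements `y` such that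
`y = y⁻¹` (the identity included). -/
def orbitSet (n t r : ℕ) : Set (Set (PointStab n)) :=
  {O | (∃ x, O = (cycPair n).orbit x) ∧ O.ncard = t ∧ {y ∈ O | y⁻¹ = y}.ncard = r}

/-- `O_{n/t,r,j}`, the set of the orbits in `O_{n/t,r}` all of whose elements `y` satisfy
`y(t) = jt`. -/
def orbitSetAt (n t r j : ℕ) : Set (Set (PointStab n)) :=
  {O ∈ orbitSet n t r | ∀ y ∈ O, y.1 (t : ZMod n) = ((j * t : ℕ) : ZMod n)}

/-! On the module induced from `(x, χ)` every `p_z # c` has rank at most one. When `F` is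
commutative its trace is `χ(c)` if `z` lies in the orbit of `x` and `c ∈ F_x`, and `0` otherwise
(`trace_e`). Multiplying out `Δ(Λ)` gives `ν = |F|⁻¹ ∑ χ((y ▷ a) a)` over the pairs `(y, a)` such
that `y ◁ a = y⁻¹` lies in the orbit and `(y ▷ a) a ∈ F_x` (`fsIndicator_eq_sum`).

If the orbit is not closed under inversion, the sum is empty and `ν = 0`. If it contains an element
equal to its inverse, each `y` in the orbit contributes the same sum of `χ((x ▷ h) h)` over `h ∈
F_x`, which is `|F_x|` or `0`; so `ν` is `1` if `χ` is trivial on all `(x ▷ h) h`, and `0` otherwise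
(`fsIndicator_of_inv_eq`). By parity, an orbit of odd length closed under inversion has such an
element, so these cases are the only ones for odd `t`.

For `C_n`, an orbit of length `t` has `F_x = ⟨a^t⟩` and `x(t) = jt`, hence `(x ▷ h) h = h^(j+1)`.
The condition on `χ` is `χ^(j+1) = 1`, with `gcd(j+1, n/t)` solutions. Closure under inversion
forces `j² ≡ 1` modulo `n/t`. Each such orbit lies in exactly one `O_{n/t,r,j}` and accounts for `t`
choices of `x` (`card_indicator_one`, `numIrrepsInd_one`); `t = 1` and `t = n` are special cases.

For the classification, an `F_x`-eigenvector in `p_x V` identifies a simple `V` with an induced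
module by Schur's lemma (`exists_equiv_of_vector`). Induced modules are isomorphic exactly when
orbit and character agree (`nonempty_equiv_iff`), which leaves one pair per orbit element. -/

namespace MatchedPair

variable {F G : Type*}

/-! ### Orbits, stabilizers and inversion in a matched pair. -/

section Group

variable [Group F] [Group G] (M : MatchedPair F G)

theorem right_eq_iff {x y : G} {a : F} : M.right y a = x ↔ y = M.right x a⁻¹ :=
  (M.rightEquiv a).eq_symm_apply.symm

theorem right_injective (a : F) : Function.Injective fun x => M.right x a :=
  (M.rightEquiv a).injective

theorem self_mem_orbit (x : G) : x ∈ M.orbit x := ⟨1, M.right_one x⟩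

theorem right_mem_orbit (x : G) (a : F) : M.right x a ∈ M.orbit x := ⟨a, rfl⟩

theorem orbit_eq_of_mem {x y : G} (h : y ∈ M.orbit x) : M.orbit y = M.orbit x := by
  obtain ⟨a, rfl⟩ := h
  ext z
  constructor
  · rintro ⟨b, rfl⟩
    exact ⟨a * b, M.right_mul x a b⟩
  · rintro ⟨b, rfl⟩
    exact ⟨a⁻¹ * b, by rw [← M.right_mul, mul_inv_cancel_left]⟩

theorem mem_orbit_comm {x y : G} : y ∈ M.orbit x ↔ x ∈ M.orbit y :=
  ⟨fun h => M.orbit_eq_of_mem h ▸ M.self_mem_orbit x,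
    fun h => M.orbit_eq_of_mem h ▸ M.self_mem_orbit y⟩

theorem mem_orbit_iff_right_eq {x y : G} : y ∈ M.orbit x ↔ ∃ a, M.right y a = x :=
  M.mem_orbit_comm

/-- Orbit-stabilizer theorem. -/
theorem ncard_orbit_mul_card_stab [Finite F] (x : G) :
    (M.orbit x).ncard * Nat.card (M.stab x) = Nat.card F := by
  -- Inverting `a` turns the right action into a left one with the same orbits and stabilizers.
  let _ : MulAction F G :=
    { smul := fun a y => M.right y a⁻¹
      one_smul := fun y => by
        change M.right y 1⁻¹ = y
        rw [inv_one, M.right_one]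
      mul_smul := fun a b y => by
        change M.right y (a * b)⁻¹ = M.right (M.right y b⁻¹) a⁻¹
        rw [mul_inv_rev, M.right_mul] }
  have h1 : MulAction.orbit F x = M.orbit x := by
    ext y
    constructor
    · rintro ⟨a, rfl⟩
      exact ⟨a⁻¹, rfl⟩
    · rintro ⟨a, rfl⟩
      refine ⟨a⁻¹, ?_⟩
      change M.right x a⁻¹⁻¹ = _
      rw [inv_inv]
  have h2 : MulAction.stabilizer F x = M.stab x := by
    ext a
    rw [← (M.stab x).inv_mem_iff]
    rfl
  rw [← h1, ← h2, ← Nat.card_coe_set_eq,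
    Nat.card_congr (MulAction.orbitEquivQuotientStabilizer F x),
    ← Subgroup.card_eq_card_quotient_mul_card_subgroup]

/-- The case of numerator `1` in `right_div`. It shows that inversion maps orbits into orbits. -/
theorem inv_right_left (x : G) (a : F) : M.right x⁻¹ (M.left x a) = (M.right x a)⁻¹ := by
  have h := M.right_div 1 x a
  rwa [one_mul, M.one_right, one_mul] at h

/-- An orbit that contains the inverse of one of its elements is closed under inversion. -/
theorem inv_mem_orbit {x y : G} (hx : x⁻¹ ∈ M.orbit x) (hy : y ∈ M.orbit x) :
    y⁻¹ ∈ M.orbit x := by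
  obtain ⟨b, rfl⟩ := hy
  rw [← M.inv_right_left, ← M.orbit_eq_of_mem hx]
  exact M.right_mem_orbit _ _

/-- An orbit of odd length that is closed under inversion contains an involution or the identity. -/
theorem exists_inv_eq_self [Finite F] {x : G} (hx : x⁻¹ ∈ M.orbit x)
    (hodd : Odd (M.orbit x).ncard) : ∃ y ∈ M.orbit x, y⁻¹ = y := by
  classical
  have : Finite (M.orbit x) := Set.finite_range _
  have : Fintype (M.orbit x) := Fintype.ofFinite _
  let σ : Equiv.Perm (M.orbit x) := Function.Involutive.toPerm
    (fun y => ⟨(y.1)⁻¹, M.inv_mem_orbit hx y.2⟩) (fun y => Subtype.ext (inv_inv y.1))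
  have hσ : σ ^ 2 ^ 1 = 1 := by
    ext y
    rw [pow_one, pow_two]
    exact inv_inv y.1
  -- Inversion permutes the orbit with cycles of length at most two, so odd length leaves a fixed
  -- point.
  obtain ⟨y, hy⟩ := Equiv.Perm.exists_fixed_point_of_prime (p := 2) (n := 1) (by
    rw [← Nat.card_eq_fintype_card, Nat.card_coe_set_eq]
    exact hodd.not_two_dvd_nat) hσ
  exact ⟨y.1, y.2, congrArg Subtype.val hy⟩

end Group

/-! ### Commutative `F`: data constant along an orbit. -/

section CommGroup

variable [CommGroup F] [Group G] (M : MatchedPair F G)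

theorem stab_right (x : G) (a : F) : M.stab (M.right x a) = M.stab x := by
  ext b
  rw [mem_stab, mem_stab, ← M.right_mul, mul_comm, M.right_mul]
  exact (M.right_injective a).eq_iff

theorem stab_eq_of_mem {x y : G} (h : y ∈ M.orbit x) : M.stab y = M.stab x := by
  obtain ⟨a, rfl⟩ := h
  exact M.stab_right x a

/-- Expanding `x ▷ bh = x ▷ hb` by `left_mul` in both orders and cancelling `x ▷ b` gives this. For
`C_n` it makes `y(t)` constant along an orbit. -/
theorem left_right_of_mem_stab (x : G) (b : F) {h : F} (hh : h ∈ M.stab x) :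
    M.left (M.right x b) h = M.left x h := by
  have h1 := M.left_mul x b h
  rw [mul_comm b h, M.left_mul x h b, M.mem_stab.mp hh, mul_comm] at h1
  exact (mul_left_cancel h1).symm

/-- The orbit is shared, so `F_x = F_{x⁻¹}`; and `x⁻¹ ◁ (x ▷ h) = (x ◁ h)⁻¹ = x⁻¹`. -/
theorem left_mem_stab {x h : _} (hx : x⁻¹ ∈ M.orbit x) (hh : h ∈ M.stab x) :
    M.left x h ∈ M.stab x := by
  rw [← M.stab_eq_of_mem hx, mem_stab, M.inv_right_left, M.mem_stab.mp hh]

/-- The endomorphism `h ↦ (x ▷ h) h` of the stabilizer of `x`. -/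
def leftMulSelf {x : G} (hx : x⁻¹ ∈ M.orbit x) : M.stab x →* M.stab x where
  toFun h := ⟨M.left x h * h, (M.stab x).mul_mem (M.left_mem_stab hx h.2) h.2⟩
  map_one' := by
    ext
    simp [M.left_one]
  map_mul' a b := by
    ext
    simp only [Subgroup.coe_mul, M.left_mul, M.mem_stab.mp a.2]
    exact mul_mul_mul_comm _ _ _ _

/-- In the orbit of an involution `x`, the solutions `a` of `y ◁ a = y⁻¹` form a coset of the
stabilizer, on which `(y ▷ a) a` takes the values `(x ▷ h) h`. -/
theorem exists_right_mul_eq_inv {x y : G} (hx : x⁻¹ = x) (hy : y ∈ M.orbit x) :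
    ∃ c : F, (∀ a, M.right y (c * a) = y⁻¹ ↔ a ∈ M.stab x) ∧
      ∀ h ∈ M.stab x, M.left y (c * h) * (c * h) = M.left x h * h := by
  obtain ⟨b, rfl⟩ := hy
  have h0 : M.left x (M.left x b) = b := by
    rw [← M.mul_left]
    nth_rw 1 [← hx]
    rw [inv_mul_cancel, M.one_left]
  have h1 : (M.right x b)⁻¹ = M.right x (M.left x b) := by
    rw [← M.inv_right_left, hx]
  -- With `y = x ◁ b`, the factor `b⁻¹` carries `y` back to `x`, and `x ▷ b` then carries `x = x⁻¹`
  -- to `(x ◁ b)⁻¹ = y⁻¹`. In the product all factors `b` and `x ▷ b` cancel because `x ▷ (x ▷ b) =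
  -- b`.
  refine ⟨b⁻¹ * M.left x b, fun a => ?_, fun h hh => ?_⟩
  · rw [mul_assoc, M.right_mul (M.right x b), M.right_right_inv, mul_comm, M.right_mul, h1]
    exact (M.right_injective _).eq_iff
  · rw [mul_assoc, M.left_mul (M.right x b), M.right_right_inv, M.left_inv, M.left_mul, h0,
      M.left_right_of_mem_stab _ _ hh]
    have e : ∀ p q r s : F, p⁻¹ * (q * r) * (q⁻¹ * (p * s)) = r * s := by
      intro p q r s
      rw [mul_left_comm q⁻¹, mul_mul_mul_comm, inv_mul_cancel, one_mul, mul_mul_mul_comm,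
        mul_inv_cancel, one_mul]
    exact e _ _ _ _

end CommGroup

end MatchedPair

/-- The second orthogonality relation for the characters of a finite abelian group. -/
theorem sum_monoidHom_apply_eq_zero {A k : Type*} [CommGroup A] [Finite A] [Field k]
    [HasEnoughRootsOfUnity k (Monoid.exponent A)] [Fintype (A →* kˣ)] {a : A} (ha : a ≠ 1) :
    ∑ χ : A →* kˣ, (χ a : k) = 0 := by
  obtain ⟨ψ, hψ⟩ := CommGroup.exists_apply_ne_one_of_hasEnoughRootsOfUnity A k ha
  have h : ∑ χ : A →* kˣ, (χ a : k) = ψ a * ∑ χ : A →* kˣ, (χ a : k) := by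
    rw [Finset.mul_sum]
    exact (Fintype.sum_equiv (Equiv.mulLeft ψ) _ _ fun χ => by simp).symm
  by_contra h0
  exact hψ (Units.ext (mul_right_cancel₀ h0 (by rw [← h]; simp)))

/-! ### Induced modules: traces, dimension, simplicity and maps out of them. -/

namespace Bismash

variable {k : Type*} [Field k] {F G : Type*}

section Group

variable [Group F] [Group G] {M : MatchedPair F G}

namespace Induced

variable {x : G} {χ : M.stab x →* kˣ}

theorem pure_apply_self (b : F) (v : k) : (pure χ b v).1 b = v := by
  have h : b⁻¹ * b ∈ M.stab x := by
    rw [inv_mul_cancel]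
    exact one_mem _
  have h1 : (⟨b⁻¹ * b, h⟩ : M.stab x) = 1 := Subtype.ext (inv_mul_cancel b)
  simp only [pure]
  rw [dif_pos h, h1]
  simp

theorem pure_one_apply (h : M.stab x) : (pure χ 1 (1 : k)).1 h = ((χ h)⁻¹ : kˣ) := by
  have h1 := (pure χ 1 (1 : k)).2 1 h
  rwa [one_mul, pure_apply_self, mul_one] at h1

theorem pure_apply_of_notMem {b c : F} (h : b⁻¹ * c ∉ M.stab x) (v : k) :
    (pure χ b v).1 c = 0 := dif_neg h

theorem pure_ne_zero (b : F) : pure χ b (1 : k) ≠ 0 := by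
  intro h
  have h1 := pure_apply_self (χ := χ) b (1 : k)
  rw [h] at h1
  exact zero_ne_one h1

theorem apply_eq_zero_of_notMem {x : G} (χ : M.stab x →* kˣ) {y : G} (hy : y ∉ M.orbit x) (a : F) :
    actE χ y a = 0 := by
  ext f c
  exact if_neg fun h => hy (M.mem_orbit_iff_right_eq.mpr ⟨c, h⟩)

/-- The `d` with `y ◁ d = x` form the coset `c F_x`, and the functions in the module supported there
form the line through `pure χ c 1`. The operator thus has rank at most one, and its trace is read
off from this formula. -/
theorem actE_apply {y : G} {c : F} (hc : M.right y c = x) (a : F) (f : Induced k M x χ) :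
    actE χ y a f = f.1 (a⁻¹ * c) • pure χ c 1 := by
  classical
  ext d
  change (if M.right y d = x then f.1 (a⁻¹ * d) else 0) = f.1 (a⁻¹ * c) * (pure χ c 1).1 d
  have hd : M.right y d = x ↔ c⁻¹ * d ∈ M.stab x := by
    rw [MatchedPair.mem_stab, ← hc, ← M.right_mul, mul_inv_cancel_left]
  split_ifs with h
  · have e1 := f.2 (a⁻¹ * c) ⟨_, hd.mp h⟩
    have e2 := (pure χ c (1 : k)).2 c ⟨_, hd.mp h⟩
    simp only [mul_assoc, mul_inv_cancel_left, pure_apply_self, mul_one] at e1 e2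
    rw [e1, e2, mul_comm]
  · rw [pure_apply_of_notMem (fun h1 => h (hd.mpr h1)), mul_zero]

theorem trace_actE [Finite F] {y : G} {c : F} (hc : M.right y c = x) (a : F) :
    LinearMap.trace k (Induced k M x χ) (actE χ y a) = (pure χ c (1 : k)).1 (a⁻¹ * c) := by
  have h : actE χ y a =
      ((LinearMap.proj (a⁻¹ * c)).comp (Induced k M x χ).subtype).smulRight (pure χ c 1) :=
    LinearMap.ext fun f => actE_apply hc a f
  rw [h, LinearMap.trace_smulRight]
  rfl

variable [Fintype G]

theorem e_smul (y : G) (a : F) (f : Induced k M x χ) : e k M y a • f = actE χ y a f := by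
  rw [smul_def, act, lift_e]

/-- The unit is `∑ p_y # 1`, and each summand has trace `1` or `0` according as `y` is in the orbit
or not. Characteristic zero recovers the dimension from the trace of the identity. -/
theorem finrank_eq [Finite F] [CharZero k] :
    Module.finrank k (Induced k M x χ) = (M.orbit x).ncard := by
  classical
  have h : ∀ y : G, LinearMap.trace k (Induced k M x χ) (actE χ y 1) =
      if y ∈ M.orbit x then 1 else 0 := by
    intro y
    split_ifs with hy
    · obtain ⟨c, hc⟩ := M.mem_orbit_iff_right_eq.mp hy
      rw [trace_actE hc, inv_one, one_mul, pure_apply_self]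
    · rw [apply_eq_zero_of_notMem χ hy, map_zero]
  have h1 := LinearMap.trace_one k (Induced k M x χ)
  rw [← act_one, one_def, map_sum, map_sum] at h1
  simp only [act, lift_e, h, Finset.sum_boole] at h1
  rw [← Nat.cast_inj (R := k), ← h1, Set.ncard_eq_toFinset_card', Set.toFinset]
  congr 2
  ext y
  simp

/-- If `f(c) ≠ 0`, an idempotent `p_y # 1` cuts `f` down to a multiple of `c ⊗ 1`; the elements `p_y
# dc⁻¹` then reach every `d ⊗ 1`, and these span. -/
theorem isSimpleModule : IsSimpleModule (Bismash k M) (Induced k M x χ) := by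
  classical
  have : Nontrivial (Induced k M x χ) := ⟨_, _, pure_ne_zero (χ := χ) 1⟩
  rw [isSimpleModule_iff]
  refine { eq_bot_or_eq_top := fun N => or_iff_not_imp_left.mpr fun hN => ?_ }
  obtain ⟨f, hf, hf0⟩ := N.exists_mem_ne_zero_of_ne_bot hN
  obtain ⟨c, hc⟩ : ∃ c, f.1 c ≠ 0 := by
    by_contra! h
    exact hf0 (Subtype.ext (funext h))
  have hsmul : ∀ (r : k) {g : Induced k M x χ}, g ∈ N → r • g ∈ N := by
    intro r g hg
    rw [← one_smul (Bismash k M) g, ← smul_assoc]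
    exact N.smul_mem _ hg
  have h1 : pure χ c 1 ∈ N := by
    have h2 := N.smul_mem (e k M (M.right x c⁻¹) 1) hf
    rw [e_smul, actE_apply (M.right_inv_right x c), inv_one, one_mul] at h2
    have h3 := hsmul (f.1 c)⁻¹ h2
    rwa [smul_smul, inv_mul_cancel₀ hc, one_smul] at h3
  have h2 : ∀ d, pure χ d 1 ∈ N := by
    intro d
    have h3 := N.smul_mem (e k M (M.right x d⁻¹) (d * c⁻¹)) h1
    rwa [e_smul_pure, inv_mul_cancel_right, if_pos (M.right_inv_right x d)] at h3
  refine eq_top_iff.mpr fun g _ => ?_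
  rw [← one_smul (Bismash k M) g, one_def, Finset.sum_smul]
  refine N.sum_mem fun y _ => ?_
  rw [e_smul]
  by_cases hy : y ∈ M.orbit x
  · obtain ⟨d, hd⟩ := M.mem_orbit_iff_right_eq.mp hy
    rw [actE_apply hd]
    exact hsmul _ (h2 d)
  · rw [apply_eq_zero_of_notMem χ hy]
    exact N.zero_mem

/-- A vector on which `p_x # h` acts as `χ(h)` for all `h ∈ F_x` defines a homomorphism from the
induced module. -/
noncomputable def homOfVector [Fintype F] {V : Type*} [AddCommGroup V] [Module k V]
    [Module (Bismash k M) V] [IsScalarTower k (Bismash k M) V] (w : V) :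
    Induced k M x χ →ₗ[Bismash k M] V where
  -- Summing over all of `F` instead of coset representatives gives a linear map for any `w`; for an
  -- eigenvector each coset is counted `|F_x|` times, whence the factor in `homOfVector_pure_one`.
  toFun f := ∑ c : F, f.1 c • e k M (M.right x c⁻¹) c • w
  map_add' f g := by simp [add_smul, Finset.sum_add_distrib]
  map_smul' r f := by
    classical
    rw [RingHom.id_apply]
    induction r using induction with
    | add r s hr hs => simp [add_smul, Finset.sum_add_distrib, hr, hs]
    | smul r s hs =>
      rw [smul_assoc, smul_assoc, ← hs, Finset.smul_sum]
      simp [smul_smul]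
    | h0 => simp
    | he y a =>
    rw [Finset.smul_sum]
    symm
    refine Fintype.sum_equiv (Equiv.mulLeft a) _ _ fun c => ?_
    have hsc : e k M y a • f.1 c • e k M (M.right x c⁻¹) c • w =
        f.1 c • (e k M y a * e k M (M.right x c⁻¹) c) • w := by
      rw [smul_algebra_smul_comm, mul_smul]
    rw [hsc, e_mul_e, e_smul]
    change _ = (if M.right y (a * c) = x then f.1 (a⁻¹ * (a * c)) else 0) • _
    have hiff : M.right x c⁻¹ = M.right y a ↔ M.right y (a * c) = x := by
      rw [eq_comm, ← M.right_eq_iff, M.right_mul]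
    rw [inv_mul_cancel_left]
    simp only [hiff, Equiv.coe_mulLeft]
    split_ifs with h
    · rw [← M.right_eq_iff.mp h]
    · simp

theorem homOfVector_pure_one [Fintype F] {V : Type*} [AddCommGroup V] [Module k V]
    [Module (Bismash k M) V] [IsScalarTower k (Bismash k M) V] {w : V}
    (hw : ∀ h : M.stab x, e k M x h • w = (χ h : k) • w) :
    homOfVector (χ := χ) w (pure χ 1 1) = (Nat.card (M.stab x) : k) • w := by
  classical
  have : Fintype (M.stab x) := Fintype.ofFinite _
  change ∑ c : F, (pure χ 1 (1 : k)).1 c • e k M (M.right x c⁻¹) c • w = _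
  have h1 : ∀ c : F, (pure χ 1 (1 : k)).1 c • e k M (M.right x c⁻¹) c • w =
      if c ∈ M.stab x then w else 0 := by
    intro c
    split_ifs with hc
    · have h2 := pure_one_apply (χ := χ) ⟨c, hc⟩
      have h3 := hw ⟨c, hc⟩
      have h4 : M.right x c⁻¹ = x := (M.stab x).inv_mem hc
      simp only at h2 h3
      rw [h4, h2, h3, smul_smul, Units.inv_mul, one_smul]
    · rw [pure_apply_of_notMem (by simpa using hc), zero_smul]
  rw [Finset.sum_congr rfl fun c _ => h1 c, ← Finset.sum_filter, Finset.sum_const,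
    ← Nat.cast_smul_eq_nsmul k, Nat.card_eq_fintype_card, Fintype.card_subtype]

/-- Schur's lemma applies once `homOfVector w` is nonzero, and it sends `pure χ 1 1` to `|F_x| w ≠
0`. -/
theorem exists_equiv_of_vector [Fintype F] [CharZero k] {V : Type*} [AddCommGroup V] [Module k V]
    [Module (Bismash k M) V] [IsScalarTower k (Bismash k M) V] [IsSimpleModule (Bismash k M) V]
    {w : V} (hw0 : w ≠ 0) (hw : ∀ h : M.stab x, e k M x h • w = (χ h : k) • w) :
    Nonempty (Induced k M x χ ≃ₗ[Bismash k M] V) := by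
  have := isSimpleModule (k := k) (χ := χ)
  refine ⟨LinearEquiv.ofBijective (homOfVector w) (LinearMap.bijective_of_ne_zero fun h => ?_)⟩
  have h1 := homOfVector_pure_one hw
  rw [h, LinearMap.zero_apply] at h1
  exact smul_ne_zero (Nat.cast_ne_zero.mpr Nat.card_pos.ne') hw0 h1.symm

end Induced

end Group

/-! ### Classification of the simple modules, and their indicators. -/

section CommGroup

variable [CommGroup F] [Group G] {M : MatchedPair F G} [Fintype G]

namespace Induced

variable {x : G} {χ : M.stab x →* kˣ}

/-- Commutativity turns `f(h⁻¹c)` into `f(ch⁻¹) = χ(h) f(c)`, so `F_x` acts through `χ` on the image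
of every `p_y # 1`, not only of `p_x # 1`. -/
theorem e_smul_of_mem_stab (y : G) (h : M.stab x) (f : Induced k M x χ) :
    e k M y h • f = (χ h : k) • e k M y 1 • f := by
  classical
  ext c
  simp only [e_smul]
  change (if M.right y c = x then f.1 ((h : F)⁻¹ * c) else 0) =
    χ h * (if M.right y c = x then f.1 (1⁻¹ * c) else 0)
  have h1 := f.2 c h⁻¹
  rw [map_inv, inv_inv] at h1
  rw [inv_one, one_mul, mul_ite, mul_zero, ← h1, Subgroup.coe_inv, mul_comm c]

theorem nonempty_equiv_iff [Fintype F] [CharZero k] {x y : G} (χ : M.stab x →* kˣ)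
    (ψ : M.stab y →* kˣ) :
    Nonempty (Induced k M y ψ ≃ₗ[Bismash k M] Induced k M x χ) ↔
      y ∈ M.orbit x ∧ ∀ (h : F) (hx : h ∈ M.stab x) (hy : h ∈ M.stab y), ψ ⟨h, hy⟩ = χ ⟨h, hx⟩ := by
  classical
  have := isSimpleModule (k := k) (χ := χ)
  constructor
  · rintro ⟨φ⟩
    have hu : e k M y 1 • pure ψ 1 (1 : k) = pure ψ 1 1 := by
      rw [e_smul_pure, one_mul, if_pos (M.right_one y)]
    have hu0 : φ (pure ψ 1 1) ≠ 0 := fun h => pure_ne_zero (χ := ψ) 1 (φ.map_eq_zero_iff.mp h)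
    have hv : e k M y 1 • φ (pure ψ 1 1) = φ (pure ψ 1 1) := by rw [← map_smul, hu]
    refine ⟨?_, fun h hx hy => Units.ext ?_⟩
    · by_contra hy
      rw [e_smul, apply_eq_zero_of_notMem χ hy] at hv
      exact hu0 hv.symm
    · have h1 := e_smul_of_mem_stab y ⟨h, hx⟩ (φ (pure ψ 1 1))
      rw [hv] at h1
      have h2 := congrArg φ (e_smul_of_mem_stab y ⟨h, hy⟩ (pure ψ 1 (1 : k)))
      rw [hu, map_smul, h1] at h2
      -- `φ` is linear over the algebra, so scalars of `k` pass through it as multiples of the unit.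
      have h3 : φ ((ψ ⟨h, hy⟩ : k) • pure ψ 1 (1 : k)) = (ψ ⟨h, hy⟩ : k) • φ (pure ψ 1 1) := by
        rw [← one_smul (Bismash k M) (pure ψ 1 (1 : k)), ← smul_assoc, map_smul, smul_assoc,
          one_smul, one_smul]
      rw [h3] at h2
      exact (smul_left_injective k hu0 h2).symm
  · rintro ⟨hy, h⟩
    obtain ⟨c, hc⟩ := M.mem_orbit_iff_right_eq.mp hy
    have hs : M.stab y = M.stab x := M.stab_eq_of_mem hy
    -- The vector `c ⊗ 1` with `y ◁ c = x` is the eigenvector that embeds the module of `(y, ψ)`.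
    have hu : e k M y 1 • pure χ c (1 : k) = pure χ c 1 := by
      rw [e_smul_pure, one_mul, if_pos hc]
    refine exists_equiv_of_vector (pure_ne_zero (χ := χ) c) fun g => ?_
    have hg : g.1 ∈ M.stab x := hs ▸ g.2
    have h1 := e_smul_of_mem_stab y ⟨g.1, hg⟩ (pure χ c (1 : k))
    rwa [hu, ← h g hg g.2] at h1

omit [Fintype G] in
open Classical in
/-- The trace of `p_z # c` on the induced module. -/
theorem trace_e [Finite F] (z : G) (c : F) :
    LinearMap.trace k (Induced k M x χ) (actE χ z c) =
      if h : c ∈ M.stab x then if z ∈ M.orbit x then (χ ⟨c, h⟩ : k) else 0 else 0 := by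
  by_cases hz : z ∈ M.orbit x
  · obtain ⟨d, hd⟩ := M.mem_orbit_iff_right_eq.mp hz
    rw [trace_actE hd]
    by_cases hc : c ∈ M.stab x
    · have h1 := (pure χ d (1 : k)).2 d ⟨c, hc⟩⁻¹
      rw [map_inv, inv_inv, pure_apply_self, mul_one, Subgroup.coe_inv, mul_comm d] at h1
      rw [h1, dif_pos hc, if_pos hz]
    · rw [dif_neg hc, pure_apply_of_notMem]
      rwa [mul_comm c⁻¹, inv_mul_cancel_left, Subgroup.inv_mem_iff]
  · simp [apply_eq_zero_of_notMem χ hz, hz]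

/-- Every simple module is induced. -/
theorem exists_equiv_of_isSimpleModule [Fintype F] [CharZero k] [IsAlgClosed k] (V : Type*)
    [AddCommGroup V] [Module k V] [Module (Bismash k M) V] [IsScalarTower k (Bismash k M) V]
    [IsSimpleModule (Bismash k M) V] :
    ∃ (x : G) (χ : M.stab x →* kˣ), Nonempty (Induced k M x χ ≃ₗ[Bismash k M] V) := by
  classical
  have := IsSimpleModule.nontrivial (Bismash k M) V
  obtain ⟨v, hv⟩ := exists_ne (0 : V)
  obtain ⟨x, hx⟩ : ∃ x, e k M x 1 • v ≠ 0 := by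
    by_contra! h
    rw [← one_smul (Bismash k M) v, one_def, Finset.sum_smul] at hv
    exact hv (Finset.sum_eq_zero fun x _ => h x)
  have : Fintype (M.stab x) := Fintype.ofFinite _
  have : NeZero (Monoid.exponent (M.stab x)) := ⟨Monoid.exponent_ne_zero_of_finite⟩
  have : Finite (M.stab x →* kˣ) := by
    obtain ⟨φ⟩ := CommGroup.monoidHom_mulEquiv_of_hasEnoughRootsOfUnity (M.stab x) k
    exact Finite.of_equiv _ φ.symm.toEquiv
  have : Fintype (M.stab x →* kˣ) := Fintype.ofFinite _
  -- Up to the factor `|F_x|`, the `χ`-isotypic component of `p_x v`.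
  let w (χ : M.stab x →* kˣ) : V := ∑ h : M.stab x, (χ h⁻¹ : k) • e k M x h • v
  have hw : ∀ (χ : M.stab x →* kˣ) (h : M.stab x), e k M x h • w χ = (χ h : k) • w χ := by
    intro χ h
    simp only [w, Finset.smul_sum]
    refine Fintype.sum_equiv (Equiv.mulLeft h) _ _ fun g => ?_
    rw [smul_algebra_smul_comm, ← mul_smul, e_mul_e, if_pos (M.mem_stab.mp h.2).symm, smul_smul,
      ← Units.val_mul, ← map_mul, Equiv.coe_mulLeft, mul_inv_rev, mul_left_comm, mul_inv_cancel,
      mul_one, Subgroup.coe_mul]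
  -- By orthogonality only `h = 1` survives the sum over `χ`, so some `w χ` is nonzero.
  have hsum : ∑ χ, w χ = (Fintype.card (M.stab x →* kˣ) : k) • e k M x 1 • v := by
    simp only [w]
    rw [Finset.sum_comm, Finset.sum_eq_single 1]
    · simp [Nat.cast_smul_eq_nsmul]
    · intro h _ h1
      rw [← Finset.sum_smul, sum_monoidHom_apply_eq_zero (inv_ne_one.mpr h1), zero_smul]
    · simp
  obtain ⟨χ, hχ⟩ : ∃ χ, w χ ≠ 0 := by
    by_contra! h
    rw [Finset.sum_eq_zero fun χ _ => h χ] at hsum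
    exact smul_ne_zero (Nat.cast_ne_zero.mpr Fintype.card_ne_zero) hx hsum.symm
  exact ⟨x, χ, exists_equiv_of_vector hχ (hw χ)⟩

/-- Every simple module is isomorphic to as many of the modules `Induced k M x χ` as its
dimension. -/
theorem card_nonempty_equiv [Fintype F] [CharZero k] (x : G) (χ : M.stab x →* kˣ) :
    Nat.card {p : Σ y : G, (M.stab y →* kˣ) //
      Nonempty (Induced k M p.1 p.2 ≃ₗ[Bismash k M] Induced k M x χ)} = (M.orbit x).ncard := by
  rw [← Nat.card_coe_set_eq]
  -- The pair `(y, ψ)` is sent to `y`; since `F_y = F_x`, the character `ψ` is forced to be `χ`.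
  refine Nat.card_congr (Equiv.ofBijective
    (fun p => ⟨p.1.1, ((nonempty_equiv_iff χ p.1.2).mp p.2).1⟩) ⟨?_, ?_⟩)
  · rintro ⟨⟨y, ψ⟩, h⟩ ⟨⟨y', ψ'⟩, h'⟩ he
    obtain rfl : y = y' := congrArg Subtype.val he
    congr 2
    ext g
    have hg : g.1 ∈ M.stab x := by
      rw [← M.stab_eq_of_mem ((nonempty_equiv_iff χ ψ).mp h).1]
      exact g.2
    rw [((nonempty_equiv_iff χ ψ).mp h).2 g hg g.2, ((nonempty_equiv_iff χ ψ').mp h').2 g hg g.2]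
  · rintro ⟨y, hy⟩
    have hs : M.stab y = M.stab x := M.stab_eq_of_mem hy
    exact ⟨⟨⟨y, χ.comp (Subgroup.inclusion hs.le)⟩,
      (nonempty_equiv_iff χ _).mpr ⟨hy, fun h hx hy => rfl⟩⟩, rfl⟩

variable [Fintype F]

-- The product of the two tensor factors survives when `y = y⁻¹ ◁ (y ▷ a)`, and the right side is
-- `(y ◁ a)⁻¹`.
omit [Fintype F] in
open Classical in
theorem mul_comul_e_one (a : F) :
    LinearMap.mul' k (Bismash k M) (Coalgebra.comul (R := k) (e k M 1 a)) =
      ∑ y : G, if M.right y a = y⁻¹ then e k M y⁻¹ (M.left y a * a) else 0 := by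
  rw [comul_e, map_sum]
  refine Finset.sum_congr rfl fun y _ => ?_
  rw [LinearMap.mul'_apply, e_mul_e, one_mul, M.inv_right_left]
  have h : y = (M.right y a)⁻¹ ↔ M.right y a = y⁻¹ := by
    rw [eq_comm, inv_eq_iff_eq_inv]
  simp only [h]

open Classical in
theorem fsIndicator_eq_sum : fsIndicator (integral k M) (Induced k M x χ) =
    (Fintype.card F : k)⁻¹ * ∑ y : G, ∑ a : F, if M.right y a = y⁻¹ ∧ y⁻¹ ∈ M.orbit x then
      if h : M.left y a * a ∈ M.stab x then (χ ⟨_, h⟩ : k) else 0 else 0 := by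
  have hact : ∀ f : Bismash k M,
      LinearMap.trace k (Induced k M x χ) (Algebra.lsmul k k (Induced k M x χ) f) =
        LinearMap.trace k (Induced k M x χ) (act χ f) := fun f => rfl
  rw [fsIndicator, hact, integral, map_smul, map_smul, map_smul, map_smul, smul_eq_mul]
  congr 1
  simp only [map_sum, mul_comul_e_one]
  rw [Finset.sum_comm]
  refine Finset.sum_congr rfl fun y _ => Finset.sum_congr rfl fun a _ => ?_
  by_cases h : M.right y a = y⁻¹
  · rw [if_pos h, act, lift_e, trace_e]
    by_cases hy : y⁻¹ ∈ M.orbit x <;> simp [h, hy]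
  · rw [if_neg h, if_neg (fun h1 => h h1.1), map_zero, map_zero]

/-- The indicator vanishes if the orbit is not closed under inversion. -/
theorem fsIndicator_of_inv_notMem (hx : x⁻¹ ∉ M.orbit x) :
    fsIndicator (integral k M) (Induced k M x χ) = (0 : k) := by
  classical
  rw [fsIndicator_eq_sum]
  refine mul_eq_zero_of_right _ (Finset.sum_eq_zero fun y _ => Finset.sum_eq_zero fun a _ => ?_)
  refine if_neg fun ⟨h1, h2⟩ => hx ?_
  -- A nonzero term would put both `y` and `y⁻¹ = y ◁ a` in the orbit of `x`.
  have h3 : y ∈ M.orbit x := by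
    rw [← M.orbit_eq_of_mem h2, ← h1]
    exact M.mem_orbit_comm.mp (M.right_mem_orbit y a)
  have h4 : M.orbit y = M.orbit x := M.orbit_eq_of_mem h3
  rw [← h4] at h2 ⊢
  exact M.inv_mem_orbit h2 (h4 ▸ M.self_mem_orbit x)

open Classical in
/-- The indicator of an induced module whose orbit contains an involution. -/
theorem fsIndicator_of_inv_eq [CharZero k] (hx : x⁻¹ ∈ M.orbit x) {z : G} (hz : z ∈ M.orbit x)
    (hinv : z⁻¹ = z) : fsIndicator (integral k M) (Induced k M x χ) =
      if χ.comp (M.leftMulSelf hx) = 1 then (1 : k) else 0 := by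
  have : Fintype (M.stab x) := Fintype.ofFinite _
  let f : M.stab x →* k := (Units.coeHom k).comp (χ.comp (M.leftMulSelf hx))
  have hstab : M.stab z = M.stab x := M.stab_eq_of_mem hz
  have horb : M.orbit z = M.orbit x := M.orbit_eq_of_mem hz
  have hleft : ∀ h ∈ M.stab x, M.left z h = M.left x h := by
    obtain ⟨b, rfl⟩ := hz
    exact fun h => M.left_right_of_mem_stab x b
  -- For `y` in the orbit the solutions `a` form a coset of `F_x`, and the sum over it does not
  -- depend on `y`.
  have key : ∀ y : G, (∑ a : F, if M.right y a = y⁻¹ ∧ y⁻¹ ∈ M.orbit x then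
      if h : M.left y a * a ∈ M.stab x then (χ ⟨_, h⟩ : k) else 0 else 0) =
      if y ∈ M.orbit x then ∑ h : M.stab x, f h else 0 := by
    intro y
    split_ifs with hy
    · obtain ⟨c, h1, h2⟩ := M.exists_right_mul_eq_inv hinv (horb ▸ hy : y ∈ M.orbit z)
      rw [hstab] at h1 h2
      have hy' := M.inv_mem_orbit hx hy
      rw [← Equiv.sum_comp (Equiv.mulLeft c)]
      simp only [Equiv.coe_mulLeft, h1, hy', and_true]
      rw [← Finset.sum_filter, Finset.sum_subtype (p := fun a => a ∈ M.stab x) _ (by simp)]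
      refine Finset.sum_congr rfl fun h _ => ?_
      have h3 : M.left y (c * h) * (c * h) = (M.leftMulSelf hx h).1 := by
        rw [h2 h h.2, hleft h h.2]
        rfl
      simp only [h3]
      exact dif_pos (M.leftMulSelf hx h).2
    · refine Finset.sum_eq_zero fun a _ => if_neg fun ⟨_, h2⟩ => hy ?_
      rw [← inv_inv y]
      exact M.inv_mem_orbit hx h2
  have hf : f = 1 ↔ χ.comp (M.leftMulSelf hx) = 1 := by
    simp only [DFunLike.ext_iff]
    exact forall_congr' fun h => Units.val_eq_one
  have hcard := M.ncard_orbit_mul_card_stab x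
  rw [fsIndicator_eq_sum]
  simp only [key]
  rw [← Finset.sum_filter, Finset.sum_const, nsmul_eq_mul, sum_hom_units]
  simp only [hf]
  split_ifs
  -- If the character is trivial, the total is the orbit length times `|F_x|`, that is `|F|`.
  · rw [← Nat.cast_mul, inv_mul_eq_one₀ (Nat.cast_ne_zero.mpr Fintype.card_ne_zero),
      ← Nat.card_eq_fintype_card, ← hcard, Nat.card_eq_fintype_card, Set.ncard_eq_toFinset_card',
      Set.toFinset]
    congr 3
    ext y
    simp
  · simp

end Induced

end CommGroup

end Bismash

/-! ### Counting tools: cyclic groups, orbits and fibres. -/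

/-- A subgroup of order `m` lies in the set of solutions of `a^m = 1`, which has at most `m`
elements. -/
theorem IsCyclic.subgroup_eq_of_card_eq {A : Type*} [Group A] [IsCyclic A] [Finite A]
    {H K : Subgroup A} (h : Nat.card H = Nat.card K) : H = K := by
  classical
  have : Fintype A := Fintype.ofFinite A
  have key : ∀ L : Subgroup A, Nat.card L = Nat.card H →
      (L : Set A) = {a | a ^ Nat.card H = 1} := by
    intro L hL
    refine Set.eq_of_subset_of_ncard_le ?_ ?_ (Set.toFinite _)
    · intro a ha
      have := congrArg Subtype.val (pow_card_eq_one' (x := (⟨a, ha⟩ : L)))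
      rw [hL] at this
      exact this
    · have h1 := IsCyclic.card_pow_eq_one_le (α := A) (n := Nat.card H) Nat.card_pos
      rw [← Nat.card_coe_set_eq (L : Set A)]
      change _ ≤ Nat.card L
      rw [hL]
      refine le_trans (le_of_eq ?_) h1
      rw [Set.ncard_eq_toFinset_card']
      congr 1
      ext a
      simp
  exact SetLike.coe_injective ((key H rfl).trans (key K h.symm).symm)

/-- The dual group is isomorphic to `A`, hence cyclic, and the set is the kernel of its `d`-th power
map. -/
theorem card_pow_eq_one_of_isCyclic {A k : Type*} [CommGroup A] [IsCyclic A] [Finite A] [Field k]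
    [HasEnoughRootsOfUnity k (Monoid.exponent A)] (d : ℕ) :
    Nat.card {χ : A →* kˣ // χ ^ d = 1} = Nat.gcd d (Nat.card A) := by
  obtain ⟨φ⟩ := CommGroup.monoidHom_mulEquiv_of_hasEnoughRootsOfUnity A k
  have : IsCyclic (A →* kˣ) := isCyclic_of_surjective φ.symm φ.symm.surjective
  have : Finite (A →* kˣ) := Finite.of_equiv _ φ.symm.toEquiv
  rw [Nat.gcd_comm, ← Nat.card_congr φ.toEquiv, ← IsCyclic.card_powMonoidHom_ker]
  rfl

/-- The elements whose orbits belong to a set of orbits of length `t`. -/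
theorem MatchedPair.card_orbit_mem {F G : Type*} [Group F] [Group G] (M : MatchedPair F G)
    [Finite G] (t : ℕ) (S : Set (Set G)) (hS : ∀ O ∈ S, (∃ x, O = M.orbit x) ∧ O.ncard = t) :
    {x | M.orbit x ∈ S}.ncard = t * S.ncard := by
  classical
  have : Fintype G := Fintype.ofFinite G
  have : Fintype S := Fintype.ofFinite S
  have h1 : {x | M.orbit x ∈ S} ≃ Σ O : S, O.1 :=
    { toFun := fun x => ⟨⟨M.orbit x.1, x.2⟩, x.1, M.self_mem_orbit _⟩
      invFun := fun p => ⟨p.2.1, by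
        obtain ⟨⟨O, hO⟩, y, hy⟩ := p
        obtain ⟨x, rfl⟩ := (hS O hO).1
        change M.orbit y ∈ S
        rwa [M.orbit_eq_of_mem hy]⟩
      left_inv := fun x => rfl
      right_inv := by
        rintro ⟨⟨O, hO⟩, y, hy⟩
        obtain ⟨x, rfl⟩ := (hS O hO).1
        have h := M.orbit_eq_of_mem hy
        simp only
        congr 1
        · exact Subtype.ext h
        · congr 1
          · simp only [h]
            exact proof_irrel_heq _ _ }
  rw [← Nat.card_coe_set_eq, Nat.card_congr h1, Nat.card_sigma]
  simp only [Nat.card_coe_set_eq]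
  rw [Finset.sum_congr rfl fun O _ => (hS O.1 O.2).2, Finset.sum_const, smul_eq_mul, mul_comm,
    Finset.card_univ, ← Nat.card_eq_fintype_card, Nat.card_coe_set_eq]

theorem Nat.card_sigma_subtype {α : Type*} {β : α → Type*} [Fintype α] [∀ a, Finite (β a)]
    (P : (Σ a, β a) → Prop) :
    Nat.card {p // P p} = ∑ a, Nat.card {b : β a // P ⟨a, b⟩} := by
  rw [← Nat.card_sigma]
  exact Nat.card_congr
    { toFun := fun p => ⟨p.1.1, p.1.2, p.2⟩
      invFun := fun q => ⟨⟨q.1, q.2.1⟩, q.2.2⟩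
      left_inv := fun _ => rfl
      right_inv := fun _ => rfl }

namespace Bismash.Induced

variable {k : Type*} [Field k] [CharZero k] {F G : Type*} [CommGroup F] [Group G]
  {M : MatchedPair F G} [Fintype G] [Fintype F]

open Classical in
theorem fsIndicator_of_odd {x : G} {χ : M.stab x →* kˣ} (hodd : Odd (M.orbit x).ncard) :
    fsIndicator (integral k M) (Induced k M x χ) =
      if ∃ hx : x⁻¹ ∈ M.orbit x, χ.comp (M.leftMulSelf hx) = 1 then (1 : k) else 0 := by
  by_cases hx : x⁻¹ ∈ M.orbit x
  · obtain ⟨z, hz, hinv⟩ := M.exists_inv_eq_self hx hodd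
    simp only [fsIndicator_of_inv_eq hx hz hinv, hx, exists_true_left]
  · rw [fsIndicator_of_inv_notMem hx, if_neg fun h => hx h.1]

end Bismash.Induced

theorem MatchedPair.inv_mem_orbit_of_inv_eq {F G : Type*} [Group F] [Group G] (M : MatchedPair F G)
    {x z : G} (hz : z ∈ M.orbit x) (hinv : z⁻¹ = z) : x⁻¹ ∈ M.orbit x := by
  rw [← M.orbit_eq_of_mem hz]
  refine M.inv_mem_orbit ?_ (M.mem_orbit_comm.mp hz)
  rw [hinv]
  exact M.self_mem_orbit z

/-! ### The matched pair of `C_n` and `S_{n-1}`: the multiplier `j`. -/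

section Cyclic

variable {n : ℕ}

theorem toAdd_ofAdd_one_pow (t : ℕ) :
    (Multiplicative.ofAdd (1 : ZMod n) ^ t).toAdd = (t : ZMod n) := by
  simp

theorem cycPair_right_apply (x : PointStab n) (b : Cyc n) (u : ZMod n) :
    ((cycPair n).right x b).1 u = x.1 (u + b.toAdd) - x.1 b.toAdd :=
  cycRight_apply x b u

theorem apply_add_of_mem_stab {x : PointStab n} {b : Cyc n} (hb : b ∈ (cycPair n).stab x)
    (u : ZMod n) : x.1 (u + b.toAdd) = x.1 u + x.1 b.toAdd := by
  have h := cycPair_right_apply x b u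
  rw [(cycPair n).mem_stab.mp hb] at h
  rw [h, sub_add_cancel]

theorem apply_nat_mul_of_mem_stab {x : PointStab n} {b : Cyc n} (hb : b ∈ (cycPair n).stab x)
    (s : ℕ) : x.1 (s * b.toAdd) = s * x.1 b.toAdd := by
  induction s with
  | zero => simp [x.apply_zero]
  | succ s ih =>
    rw [Nat.cast_succ, add_mul, one_mul, apply_add_of_mem_stab hb, ih, add_mul, one_mul]

theorem apply_eq_of_mem_orbit {x y : PointStab n} {b : Cyc n} (hb : b ∈ (cycPair n).stab x)
    (hy : y ∈ (cycPair n).orbit x) : y.1 b.toAdd = x.1 b.toAdd := by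
  obtain ⟨c, rfl⟩ := hy
  exact Multiplicative.ofAdd.injective ((cycPair n).left_right_of_mem_stab x c hb)

variable [NeZero n]

theorem ncard_orbit_mul_card_stab_cyc (x : PointStab n) :
    ((cycPair n).orbit x).ncard * Nat.card ((cycPair n).stab x) = n := by
  rw [(cycPair n).ncard_orbit_mul_card_stab, Nat.card_congr Multiplicative.toAdd, Nat.card_zmod]

theorem card_stab_of_ncard_orbit {x : PointStab n} {t : ℕ}
    (hx : ((cycPair n).orbit x).ncard = t) : Nat.card ((cycPair n).stab x) = n / t := by
  have h := ncard_orbit_mul_card_stab_cyc x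
  rw [hx] at h
  refine (Nat.div_eq_of_eq_mul_right ?_ h.symm).symm
  exact Nat.pos_of_ne_zero fun h0 => NeZero.ne n (by rw [← h, h0, zero_mul])

theorem card_zpowers_ofAdd_one_pow {t : ℕ} (ht : t ∣ n) :
    Nat.card (Subgroup.zpowers (Multiplicative.ofAdd (1 : ZMod n) ^ t)) = n / t := by
  rw [Nat.card_zpowers, orderOf_pow, orderOf_ofAdd_eq_addOrderOf, ZMod.addOrderOf_one,
    Nat.gcd_eq_right ht]

theorem mem_stabSet_iff {t : ℕ} (ht : t ∣ n) {x : PointStab n} :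
    x ∈ stabSet n t ↔ ((cycPair n).orbit x).ncard = t := by
  constructor
  · intro h
    have h1 := ncard_orbit_mul_card_stab_cyc x
    rw [show (cycPair n).stab x = _ from h, card_zpowers_ofAdd_one_pow ht] at h1
    have h2 : 0 < n / t := Nat.div_pos (Nat.le_of_dvd (NeZero.pos n) ht)
      (Nat.pos_of_dvd_of_pos ht (NeZero.pos n))
    exact Nat.eq_of_mul_eq_mul_right h2 (h1.trans (Nat.mul_div_cancel' ht).symm)
  · intro h
    exact IsCyclic.subgroup_eq_of_card_eq
      ((card_stab_of_ncard_orbit h).trans (card_zpowers_ofAdd_one_pow ht).symm)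

theorem ofAdd_one_pow_mem_stab {t : ℕ} (ht : t ∣ n) {x : PointStab n}
    (hx : ((cycPair n).orbit x).ncard = t) :
    Multiplicative.ofAdd (1 : ZMod n) ^ t ∈ (cycPair n).stab x := by
  rw [show (cycPair n).stab x = _ from (mem_stabSet_iff ht).mpr hx]
  exact Subgroup.mem_zpowers _

theorem natCast_mul_eq_iff {t : ℕ} (ht : t ∣ n) (i j : ℕ) :
    ((i * t : ℕ) : ZMod n) = ((j * t : ℕ) : ZMod n) ↔ i ≡ j [MOD n / t] := by
  obtain ⟨m, rfl⟩ := ht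
  have ht0 : 0 < t := Nat.pos_of_ne_zero fun h => NeZero.ne (t * m) (by rw [h, zero_mul])
  rw [ZMod.natCast_eq_natCast_iff, Nat.mul_div_cancel_left m ht0, mul_comm i, mul_comm j]
  exact Nat.ModEq.mul_left_cancel_iff' ht0.ne'

theorem eq_of_modEq_of_mem_Icc {m i j : ℕ} (hi : i ∈ Finset.Icc 1 m) (hj : j ∈ Finset.Icc 1 m)
    (h : i ≡ j [MOD m]) : i = j := by
  rw [Finset.mem_Icc] at hi hj
  rw [Nat.modEq_iff_dvd] at h
  have := Int.eq_zero_of_abs_lt_dvd h (by rw [abs_lt]; omega)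
  omega

/-- If the orbit of `x` has length `t` then `x(t) = jt` for some `j`. -/
theorem exists_apply_eq_mul {t : ℕ} (ht : t ∣ n) {x : PointStab n}
    (hx : ((cycPair n).orbit x).ncard = t) :
    ∃ j ∈ Finset.Icc 1 (n / t), x.1 (t : ZMod n) = ((j * t : ℕ) : ZMod n) := by
  -- `(n/t) x(t) = x(n) = x(0) = 0`, so `x(t)` is a multiple of `t`.
  have h := apply_nat_mul_of_mem_stab (ofAdd_one_pow_mem_stab ht hx) (n / t)
  rw [toAdd_ofAdd_one_pow, ← Nat.cast_mul, Nat.div_mul_cancel ht, ZMod.natCast_self,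
    x.apply_zero, ← ZMod.natCast_zmod_val (x.1 (t : ZMod n)), ← Nat.cast_mul, eq_comm,
    ZMod.natCast_eq_zero_iff] at h
  have hv := ZMod.val_lt (x.1 (t : ZMod n))
  have hv' := ZMod.natCast_zmod_val (x.1 (t : ZMod n))
  revert hv hv' h
  generalize (x.1 (t : ZMod n)).val = v
  intro h hv hv'
  have hm : 0 < n / t := Nat.div_pos (Nat.le_of_dvd (NeZero.pos n) ht)
    (Nat.pos_of_dvd_of_pos ht (NeZero.pos n))
  nth_rw 1 [← Nat.div_mul_cancel ht] at h
  obtain ⟨i, rfl⟩ := Nat.dvd_of_mul_dvd_mul_left hm h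
  -- Representatives start at `1`, so the residue `0` is represented by `n/t`.
  rcases Nat.eq_zero_or_pos i with rfl | hi
  · refine ⟨n / t, Finset.mem_Icc.mpr ⟨hm, le_rfl⟩, ?_⟩
    rw [← hv', Nat.div_mul_cancel ht]
    simp
  · refine ⟨i, Finset.mem_Icc.mpr ⟨hi, ?_⟩, ?_⟩
    · rw [Nat.le_div_iff_mul_le (Nat.pos_of_dvd_of_pos ht (NeZero.pos n)), mul_comm]
      exact hv.le
    · rw [← hv', mul_comm]

/-- `x⁻¹` lies in the orbit, so `x⁻¹(t) = jt` too; applying `x` gives `t = x(jt) = j x(t) = j² t`.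
-/
theorem sq_modEq_one_of_inv_mem_orbit {t j : ℕ} (ht : t ∣ n) {x : PointStab n}
    (hx : ((cycPair n).orbit x).ncard = t) (hinv : x⁻¹ ∈ (cycPair n).orbit x)
    (hj : x.1 (t : ZMod n) = ((j * t : ℕ) : ZMod n)) : j ^ 2 ≡ 1 [MOD n / t] := by
  have hmem := ofAdd_one_pow_mem_stab ht hx
  have h1 := apply_eq_of_mem_orbit hmem hinv
  rw [toAdd_ofAdd_one_pow, hj] at h1
  have h2 : x.1 ((j * t : ℕ) : ZMod n) = t := by
    rw [← h1]
    exact Equiv.apply_symm_apply x.1 _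
  have h3 := apply_nat_mul_of_mem_stab hmem j
  rw [toAdd_ofAdd_one_pow, ← Nat.cast_mul, h2, hj, ← Nat.cast_mul, ← mul_assoc, ← pow_two] at h3
  rw [← natCast_mul_eq_iff ht, one_mul, h3]

/-- Both sides are homomorphisms on `⟨a^t⟩`, and on the generator `x ▷ a^t = a^(jt)`. -/
theorem leftMulSelf_eq_pow {t j : ℕ} (ht : t ∣ n) {x : PointStab n}
    (hx : ((cycPair n).orbit x).ncard = t) (hinv : x⁻¹ ∈ (cycPair n).orbit x)
    (hj : x.1 (t : ZMod n) = ((j * t : ℕ) : ZMod n)) :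
    (cycPair n).leftMulSelf hinv = powMonoidHom (j + 1) := by
  have hmem := ofAdd_one_pow_mem_stab ht hx
  have hg : (cycPair n).leftMulSelf hinv ⟨_, hmem⟩ = ⟨_, hmem⟩ ^ (j + 1) := by
    ext1
    rw [Subgroup.coe_pow, pow_succ]
    change (cycPair n).left x _ * _ = _
    congr 1
    apply Multiplicative.toAdd.injective
    change x.1 (Multiplicative.ofAdd (1 : ZMod n) ^ t).toAdd = _
    rw [toAdd_ofAdd_one_pow, toAdd_pow, toAdd_ofAdd_one_pow, hj, Nat.cast_mul, nsmul_eq_mul]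
  ext1 h
  obtain ⟨s, hs⟩ : ∃ s : ℤ, (⟨_, hmem⟩ : (cycPair n).stab x) ^ s = h := by
    have h1 : h.1 ∈ Subgroup.zpowers (Multiplicative.ofAdd (1 : ZMod n) ^ t) := by
      rw [← show (cycPair n).stab x = _ from (mem_stabSet_iff ht).mpr hx]
      exact h.2
    obtain ⟨s, hs⟩ := h1
    exact ⟨s, Subtype.ext hs⟩
  rw [← hs, map_zpow, map_zpow, hg]
  rfl

end Cyclic

/-! ### Counting the pairs `(x, χ)` by dimension and indicator. -/

section Counting

variable {k : Type*} [Field k] [CharZero k] {n : ℕ} [NeZero n]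

theorem finrank_irrep (p : IrrepIndex k n) :
    Module.finrank k (irrep p) = ((cycPair n).orbit p.1).ncard := Bismash.Induced.finrank_eq

theorem indicator_irrep_eq_zero_or_one {p : IrrepIndex k n}
    (hodd : Odd (Module.finrank k (irrep p))) :
    indicator k n (irrep p) = 0 ∨ indicator k n (irrep p) = 1 := by
  classical
  rw [finrank_irrep] at hodd
  rw [indicator, Bismash.Induced.fsIndicator_of_odd hodd]
  split_ifs
  · exact Or.inr rfl
  · exact Or.inl rfl

theorem indicator_irrep_eq_one_iff {x : PointStab n} {χ : (cycPair n).stab x →* kˣ}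
    (hodd : Odd ((cycPair n).orbit x).ncard) :
    indicator k n (irrep (⟨x, χ⟩ : IrrepIndex k n)) = 1 ↔
      ∃ hx : x⁻¹ ∈ (cycPair n).orbit x, χ.comp ((cycPair n).leftMulSelf hx) = 1 := by
  classical
  rw [indicator, Bismash.Induced.fsIndicator_of_odd hodd]
  split_ifs with h
  · simpa using h
  · simpa using h

/-- The orbits that contain an involution or the identity are those in some `orbitSetAt n t r j`,
where `r` and `j` are unique. -/
theorem exists_orbit_mem_orbitSetAt_iff {t : ℕ} (ht : t ∣ n) (hodd : Odd t) {x : PointStab n}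
    (hx : ((cycPair n).orbit x).ncard = t) (hinv : x⁻¹ ∈ (cycPair n).orbit x) :
    ∃ j₀ ∈ sqrtOne (n / t), ∃ r₀ ∈ Finset.Icc 1 t,
      x.1 (t : ZMod n) = ((j₀ * t : ℕ) : ZMod n) ∧
      ∀ j ∈ sqrtOne (n / t), ∀ r,
        (cycPair n).orbit x ∈ orbitSetAt n t r j ↔ j = j₀ ∧ r = r₀ := by
  have hmem := ofAdd_one_pow_mem_stab ht hx
  obtain ⟨j, hj, hjx⟩ := exists_apply_eq_mul ht hx
  obtain ⟨z, hz, hzinv⟩ := (cycPair n).exists_inv_eq_self hinv (hx ▸ hodd)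
  refine ⟨j, Finset.mem_filter.mpr ⟨hj, sq_modEq_one_of_inv_mem_orbit ht hx hinv hjx⟩,
    {y ∈ (cycPair n).orbit x | y⁻¹ = y}.ncard, Finset.mem_Icc.mpr ⟨?_, ?_⟩, hjx,
    fun i hi r => ⟨?_, ?_⟩⟩
  · exact (Set.ncard_pos (Set.toFinite _)).mpr ⟨z, hz, hzinv⟩
  · exact (Set.ncard_le_ncard (fun y hy => hy.1) (Set.toFinite _)).trans hx.le
  · rintro ⟨⟨-, -, hr⟩, h⟩
    refine ⟨eq_of_modEq_of_mem_Icc (Finset.mem_filter.mp hi).1 hj ?_, hr.symm⟩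
    rw [← natCast_mul_eq_iff ht, ← h x ((cycPair n).self_mem_orbit x), hjx]
  · rintro ⟨rfl, rfl⟩
    refine ⟨⟨⟨x, rfl⟩, hx, rfl⟩, fun y hy => ?_⟩
    have h := apply_eq_of_mem_orbit hmem hy
    rwa [toAdd_ofAdd_one_pow, hjx] at h

variable [IsAlgClosed k]

theorem hasEnoughRootsOfUnity_stab (x : PointStab n) :
    HasEnoughRootsOfUnity k (Monoid.exponent ((cycPair n).stab x)) := by
  have : NeZero (Monoid.exponent ((cycPair n).stab x)) := ⟨Monoid.exponent_ne_zero_of_finite⟩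
  infer_instance

theorem card_stab_monoidHom (x : PointStab n) :
    Nat.card ((cycPair n).stab x →* kˣ) = Nat.card ((cycPair n).stab x) := by
  have := hasEnoughRootsOfUnity_stab (k := k) x
  exact CommGroup.card_monoidHom_of_hasEnoughRootsOfUnity _ _

instance finite_stab_monoidHom (x : PointStab n) : Finite ((cycPair n).stab x →* kˣ) := by
  have := hasEnoughRootsOfUnity_stab (k := k) x
  obtain ⟨φ⟩ := CommGroup.monoidHom_mulEquiv_of_hasEnoughRootsOfUnity ((cycPair n).stab x) k
  exact Finite.of_equiv _ φ.symm.toEquiv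

-- At most one pair `(j, r)` contributes on the right. Both sides vanish unless the orbit has length
-- `t` and is closed under inversion; otherwise they count the solutions of `χ^(j+1) = 1` on a
-- cyclic group of order `n/t`.
open Classical in
theorem card_indicator_one {t : ℕ} (ht : t ∣ n) (hodd : Odd t) (x : PointStab n) :
    Nat.card {χ : (cycPair n).stab x →* kˣ //
      Module.finrank k (irrep (⟨x, χ⟩ : IrrepIndex k n)) = t ∧
        indicator k n (irrep (⟨x, χ⟩ : IrrepIndex k n)) = 1} =
    ∑ j ∈ sqrtOne (n / t), ∑ r ∈ Finset.Icc 1 t,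
      if (cycPair n).orbit x ∈ orbitSetAt n t r j then Nat.gcd (j + 1) (n / t) else 0 := by
  by_cases hx : ((cycPair n).orbit x).ncard = t ∧ x⁻¹ ∈ (cycPair n).orbit x
  · obtain ⟨hx, hinv⟩ := hx
    obtain ⟨j, hj, r, hr, hjx, hiff⟩ := exists_orbit_mem_orbitSetAt_iff ht hodd hx hinv
    have := hasEnoughRootsOfUnity_stab (k := k) x
    rw [Finset.sum_eq_single_of_mem j hj, Finset.sum_eq_single_of_mem r hr,
      if_pos ((hiff j hj r).mpr ⟨rfl, rfl⟩), ← card_stab_of_ncard_orbit hx,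
      ← card_pow_eq_one_of_isCyclic (k := k)]
    · refine Nat.card_congr (Equiv.subtypeEquivRight fun χ => ?_)
      rw [finrank_irrep, indicator_irrep_eq_one_iff (hx ▸ hodd)]
      simp only [hx, hinv, true_and, exists_true_left, leftMulSelf_eq_pow ht hx hinv hjx]
      simp only [DFunLike.ext_iff]
      refine forall_congr' fun h => ?_
      simp
    · exact fun s _ hs => if_neg fun h => hs ((hiff j hj s).mp h).2
    · exact fun i hi hij => Finset.sum_eq_zero fun s _ => if_neg fun h => hij ((hiff i hi s).mp h).1
  · rw [Finset.sum_eq_zero, Nat.card_eq_zero]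
    · refine Or.inl ⟨fun ⟨χ, h1, h2⟩ => hx ?_⟩
      rw [finrank_irrep] at h1
      exact ⟨h1, ((indicator_irrep_eq_one_iff (h1 ▸ hodd)).mp h2).1⟩
    · refine fun j _ => Finset.sum_eq_zero fun r hr => if_neg fun ⟨⟨_, h1, h2⟩, _⟩ => hx ⟨h1, ?_⟩
      -- The range of `r` starts at `1`, so the orbit has a self-inverse element.
      obtain ⟨z, hz, hzinv⟩ := (Set.ncard_pos (Set.toFinite _)).mp
        (lt_of_lt_of_eq (Finset.mem_Icc.mp hr).1 h2.symm)
      exact (cycPair n).inv_mem_orbit_of_inv_eq hz hzinv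

/-- The local counts depend only on the orbit of `x`; its `t` elements produce the factor `t`. -/
theorem numIrrepsInd_one {t : ℕ} (ht : t ∣ n) (hodd : Odd t) :
    numIrrepsInd k n t 1 = t * ∑ j ∈ sqrtOne (n / t), ∑ r ∈ Finset.Icc 1 t,
      Nat.gcd (j + 1) (n / t) * (orbitSetAt n t r j).ncard := by
  classical
  rw [numIrrepsInd, Nat.card_sigma_subtype, Finset.sum_congr rfl fun x _ =>
    card_indicator_one ht hodd x, Finset.sum_comm, Finset.mul_sum]
  refine Finset.sum_congr rfl fun j _ => ?_
  rw [Finset.sum_comm, Finset.mul_sum]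
  refine Finset.sum_congr rfl fun r _ => ?_
  rw [← Finset.sum_filter, Finset.sum_const, smul_eq_mul, mul_left_comm,
    ← (cycPair n).card_orbit_mem t (orbitSetAt n t r j) fun O hO => ⟨hO.1.1, hO.1.2.1⟩, mul_comm,
    Set.ncard_eq_toFinset_card']
  congr 2
  ext x
  simp

theorem numIrreps_eq {t : ℕ} (ht : t ∣ n) :
    numIrreps k n t = (n / t) * (stabSet n t).ncard := by
  classical
  have h : ∀ x : PointStab n, Nat.card {χ : (cycPair n).stab x →* kˣ //
      Module.finrank k (irrep (⟨x, χ⟩ : IrrepIndex k n)) = t} =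
      if x ∈ stabSet n t then n / t else 0 := by
    intro x
    simp only [finrank_irrep, mem_stabSet_iff ht]
    split_ifs with hx
    · rw [Nat.card_congr (Equiv.subtypeUnivEquiv fun χ => hx), card_stab_monoidHom,
        card_stab_of_ncard_orbit hx]
    · exact Nat.card_eq_zero.mpr (Or.inl ⟨fun p => hx p.2⟩)
  rw [numIrreps, Nat.card_sigma_subtype, Finset.sum_congr rfl fun x _ => h x, ← Finset.sum_filter,
    Finset.sum_const, smul_eq_mul, mul_comm, Set.ncard_eq_toFinset_card']
  congr 2
  ext x
  simp

theorem numIrreps_eq_add {t : ℕ} (hodd : Odd t) :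
    numIrreps k n t = numIrrepsInd k n t 0 + numIrrepsInd k n t 1 := by
  classical
  have : Fintype (IrrepIndex k n) := Fintype.ofFinite _
  simp only [numIrreps, numIrrepsInd, Nat.card_eq_fintype_card, Fintype.card_subtype]
  rw [← Finset.card_union_of_disjoint]
  · congr 1
    ext p
    simp only [Finset.mem_filter, Finset.mem_univ, true_and, Finset.mem_union, ← and_or_left]
    exact ⟨fun h => ⟨h, indicator_irrep_eq_zero_or_one (h ▸ hodd)⟩, fun h => h.1⟩
  · rw [Finset.disjoint_filter]
    rintro p - ⟨-, h0⟩ ⟨-, h1⟩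
    exact zero_ne_one (h0.symm.trans h1)

end Counting

/-! ### Orbits of length `1` and `n`. -/

section Length

variable {n : ℕ}

/-- The permutation `u ↦ ju`, where `j² = 1`. -/
def mulPerm (j : ZMod n) (hj : j * j = 1) : PointStab n :=
  ⟨Function.Involutive.toPerm (fun u => j * u) fun u =>
    (mul_assoc j j u).symm.trans (by rw [hj, one_mul]),
    mul_zero j⟩

theorem mulPerm_apply (j : ZMod n) (hj : j * j = 1) (u : ZMod n) : (mulPerm j hj).1 u = j * u := rfl

theorem orbit_mulPerm (j : ZMod n) (hj : j * j = 1) :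
    (cycPair n).orbit (mulPerm j hj) = {mulPerm j hj} := by
  refine Set.eq_singleton_iff_unique_mem.mpr ⟨(cycPair n).self_mem_orbit _, ?_⟩
  rintro _ ⟨b, rfl⟩
  ext u
  simp only [cycPair_right_apply, mulPerm_apply, mul_add, add_sub_cancel_right]

/-- For `t = n` the condition on `y` reads `y(0) = 0`. -/
theorem orbitSetAt_self (r j : ℕ) : orbitSetAt n n r j = orbitSet n n r := by
  refine Set.sep_eq_self_iff_mem_true.mpr fun O _ y _ => ?_
  rw [Nat.cast_mul, ZMod.natCast_self, mul_zero, y.apply_zero]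

variable [NeZero n]

theorem apply_eq_mul_apply_one {x : PointStab n} (hx : ((cycPair n).orbit x).ncard = 1)
    (u : ZMod n) : x.1 u = u * x.1 1 := by
  have h := apply_nat_mul_of_mem_stab (ofAdd_one_pow_mem_stab (one_dvd n) hx) u.val
  rwa [toAdd_ofAdd_one_pow, Nat.cast_one, mul_one, ZMod.natCast_zmod_val] at h

/-- A one-element orbit has full stabilizer, so its `x` is additive and determined by `x(1) = j`.
The orbit is that of `u ↦ ju`, a bijection because `j² = 1`. -/
theorem ncard_orbitSetAt_one {j : ℕ} (hj : j ∈ sqrtOne n) : (orbitSetAt n 1 1 j).ncard = 1 := by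
  have hj1 : (j : ZMod n) * j = 1 := by
    have h := (ZMod.natCast_eq_natCast_iff _ _ _).mpr (Finset.mem_filter.mp hj).2
    rwa [pow_two, Nat.cast_mul, Nat.cast_one] at h
  refine Set.ncard_eq_one.mpr ⟨{mulPerm (j : ZMod n) hj1}, ?_⟩
  refine Set.eq_singleton_iff_unique_mem.mpr ⟨⟨⟨⟨_, (orbit_mulPerm _ hj1).symm⟩, ?_, ?_⟩, ?_⟩, ?_⟩
  · exact Set.ncard_singleton _
  · refine Set.ncard_eq_one.mpr ⟨mulPerm (j : ZMod n) hj1, ?_⟩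
    ext y
    simp only [Set.mem_ofPred_eq, Set.mem_singleton_iff, and_iff_left_iff_imp]
    rintro rfl
    rfl
  · rintro y rfl
    rw [mulPerm_apply, Nat.cast_mul]
  · rintro _ ⟨⟨⟨x, rfl⟩, h1, -⟩, h2⟩
    have hx := h2 x ((cycPair n).self_mem_orbit x)
    rw [mul_one, Nat.cast_one] at hx
    have hxe : x = mulPerm (j : ZMod n) hj1 := by
      ext u
      rw [apply_eq_mul_apply_one h1, hx, mulPerm_apply, mul_comm]
    rw [hxe, orbit_mulPerm]

end Length

theorem mainTheorem3 {k : Type*} [Field k] [IsAlgClosed k] [CharZero k] (n : ℕ) [NeZero n] :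
    (∀ p : IrrepIndex k n, IsSimpleModule (J k n) (irrep p)) ∧
    (∀ (V : Type*) [AddCommGroup V] [Module k V] [Module (J k n) V] [IsScalarTower k (J k n) V],
      IsSimpleModule (J k n) V →
        0 < Module.finrank k V ∧
        Nat.card {p : IrrepIndex k n // Nonempty (irrep p ≃ₗ[J k n] V)} = Module.finrank k V) ∧
    numIrrepsInd k n 1 1 = ∑ j ∈ sqrtOne n, Nat.gcd (j + 1) n ∧
    (∀ t : ℕ, Odd t → t ∣ n →
      numIrrepsInd k n t 1 = t * ∑ j ∈ sqrtOne (n / t), ∑ r ∈ Finset.Icc 1 t,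
        Nat.gcd (j + 1) (n / t) * (orbitSetAt n t r j).ncard) ∧
    (Odd n → numIrrepsInd k n n 1 = n * ∑ r ∈ Finset.Icc 1 n, (orbitSet n n r).ncard) ∧
    (∀ t : ℕ, Odd t → t ∣ n →
      numIrreps k n t = (n / t) * (stabSet n t).ncard ∧
      (numIrrepsInd k n t 0 : ℤ) =
        ((n / t : ℕ) : ℤ) * ((stabSet n t).ncard : ℤ) - (numIrrepsInd k n t 1 : ℤ)) := by
  refine ⟨fun p => Bismash.Induced.isSimpleModule, ?_, ?_, fun t hodd ht => numIrrepsInd_one ht hodd,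
    fun hodd => ?_, fun t hodd ht => ⟨numIrreps_eq ht, ?_⟩⟩
  · intro V _ _ _ _ hV
    obtain ⟨x, χ, ⟨φ⟩⟩ := Bismash.Induced.exists_equiv_of_isSimpleModule (k := k)
      (M := cycPair n) V
    have hrank : Module.finrank k V = ((cycPair n).orbit x).ncard := by
      rw [← Bismash.Induced.finrank_eq (k := k) (χ := χ)]
      exact (φ.restrictScalars k).finrank_eq.symm
    rw [hrank]
    refine ⟨(Set.ncard_pos (Set.toFinite _)).mpr ⟨x, (cycPair n).self_mem_orbit x⟩, ?_⟩
    rw [← Bismash.Induced.card_nonempty_equiv (k := k) x χ]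
    exact Nat.card_congr (Equiv.subtypeEquivRight fun p =>
      ⟨fun ⟨ψ⟩ => ⟨ψ.trans φ.symm⟩, fun ⟨ψ⟩ => ⟨ψ.trans φ⟩⟩)
  · rw [numIrrepsInd_one (one_dvd n) odd_one, one_mul, Nat.div_one]
    refine Finset.sum_congr rfl fun j hj => ?_
    rw [Finset.Icc_self, Finset.sum_singleton, ncard_orbitSetAt_one hj, mul_one]
  -- For `t = n` only `j = 1` occurs, with weight `gcd(2, 1) = 1`.
  · rw [numIrrepsInd_one dvd_rfl hodd, Nat.div_self (NeZero.pos n), show sqrtOne 1 = {1} from rfl,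
      Finset.sum_singleton]
    simp [orbitSetAt_self]
  · rw [← Nat.cast_mul, ← numIrreps_eq (k := k) ht, numIrreps_eq_add hodd, Nat.cast_add,
      add_sub_cancel_right]
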